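/- **Conventions.** A $\sigma$-complete Boolean algebra is a Boolean algebra in which every sequence has a join; morphisms are Boolean homomorphisms preserving countable joins. $\mathbf{AbsMes}$ (abstract measurable spaces) is the opposite of the category of $\sigma$-complete Boolean algebras. An $\mathbf{AbsProb}$-space is an abstract measurable space with a countably additive probability measure on its algebra of events, and its morphisms are the measure-preserving $\mathbf{AbsMes}$-morphisms. A probability algebra ($\mathbf{ProbAlg}$-space) is an $\mathbf{AbsProb}$-space in which every non-zero event has positive measure; $\mathtt{Inc}:\mathbf{ProbAlg}\to\mathbf{AbsProb}$ is the inclusion of this full subcategory. The probability algebra of an $\mathbf{AbsProb}$-space $Y$ is the quotient of its algebra of events by the null ideal; the quotient map defines the natural monomorphism from $\mathtt{Inc}$ of this probability algebra to $Y$. A $\mathbf{CHProb}$-space is a compact Hausdorff space with a (Radon) probability measure on its Baire $\sigma$-algebra, with continuous measure-preserving maps as morphisms. Taking the Baire $\sigma$-algebra with its measure gives a functor $S\mapsto S_{\mathbf{AbsProb}}$, and $S_{\mathbf{ProbAlg}}$ is the probability algebra of $S_{\mathbf{AbsProb}}$. Such an $S$ has the strong Lusin property if every bounded Baire measurable $f:S\to\mathbb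 C$ agrees almost everywhere with precisely one continuous function $S\to\mathbb C$. For a probability algebra $X$, $L^\infty(X)$ is the commutative $C^*$-algebra of bounded $\mathbf{AbsMes}$-morphisms $f:\mathtt{Inc}(X)\to\mathbb C$ (that is, morphisms from the Borel algebra of $\mathbb C$ to the algebra of events of $X$ sending $\{|z|\le M\}$ to $1$ for some $M$), with trace $\tau(f)=\int_X f\,d\mu_X$. $\mathtt{Stone}(X)$ is the Gelfand spectrum of $L^\infty(X)$ (the space of characters) with the Baire probability measure representing $\tau$ under the Gelfand isomorphism $L^\infty(X)\cong C(\mathtt{Stone}(X))$. A $\mathbf{ProbAlg}$-morphism $\pi:X\to Y$ induces $\mathtt{Stone}(\pi):\mathtt{Stone}(X)\to\mathtt{Stone}(Y)$, $\mathtt{Stone}(\pi)(\chi)(f)=\chi(f\circ\mathtt{Inc}(\pi))$. A *concrete model* of $X$ is a pair $(\tilde X,\iota)$ of a $\mathbf{CHProb}$-space $\tilde X$ and an $\mathbf{AbsProb}$-morphism $\iota:\mathtt{Inc}(X)\to\tilde X_{\mathbf{AbsProb}}$ that is a monomorphism in $\mathbf{AbsMes}$. The category $\mathbf{Model}(X)$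 has these as objects; a morphism $(\tilde X,\iota)\to(\tilde X',\iota')$ is a $\mathbf{CHProb}$-morphism $T:\tilde X\to\tilde X'$ with $\iota'=T_{\mathbf{AbsProb}}\circ\iota$. **Proposition (Universality of the canonical model).** Let $X$ be a probability algebra. (i) If $(\tilde X,\iota)$ is a concrete model of $X$, then there is a $\mathbf{ProbAlg}$-isomorphism $e:X\to\tilde X_{\mathbf{ProbAlg}}$ such that $\iota$ is the composition of $\mathtt{Inc}(e)$ with the natural monomorphism $\mathtt{Inc}(\tilde X_{\mathbf{ProbAlg}})\to\tilde X_{\mathbf{AbsProb}}$. Conversely, if $\tilde X$ is a $\mathbf{CHProb}$-space and $e:X\to\tilde X_{\mathbf{ProbAlg}}$ is a $\mathbf{ProbAlg}$-isomorphism, then $(\tilde X,\iota)$, with $\iota$ defined as this composition, is a concrete model of $X$. (ii) There is a $\mathbf{ProbAlg}$-isomorphism $X\cong\mathtt{Stone}(X)_{\mathbf{ProbAlg}}$ matching each event $E$ of $X$ with the class of the set $\{\chi:\chi(1_E)=1\}$; and, $\iota_{\mathtt{Stone}(X)}:\mathtt{Inc}(X)\to\mathtt{Stone}(X)_{\mathbf{AbsProb}}$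 being the composition of $\mathtt{Inc}$ of this isomorphism with the natural monomorphism, $(\mathtt{Stone}(X),\iota_{\mathtt{Stone}(X)})$ is a concrete model of $X$. It is natural in $X$: for every $\mathbf{ProbAlg}$-morphism $\pi:X\to Y$, $\mathtt{Stone}(\pi)$ is a $\mathbf{CHProb}$-morphism and $\mathtt{Stone}(\pi)_{\mathbf{AbsProb}}\circ\iota_{\mathtt{Stone}(X)}=\iota_{\mathtt{Stone}(Y)}\circ\mathtt{Inc}(\pi)$. (iii) A concrete model $(\tilde X,\iota)$ of $X$ is an initial object of $\mathbf{Model}(X)$ if and only if $\tilde X$ has the strong Lusin property. In particular, $(\mathtt{Stone}(X),\iota_{\mathtt{Stone}(X)})$ is initial in $\mathbf{Model}(X)$. -/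

import Mathlib

open CategoryTheory MeasureTheory Topology Set
open scoped ENNReal

universe u v w

noncomputable section

namespace CanonModel

/-! ### Sigma-complete Boolean algebras and their morphisms -/

/-- A Boolean algebra is `σ`-complete if every sequence has a join (hence also a meet, by taking
complements). -/
class SigmaComplete (A : Type u) [BooleanAlgebra A] : Prop where
  exists_isLUB : ∀ s : ℕ → A, ∃ a, IsLUB (range s) a

/-- A morphism of `σ`-complete Boolean algebras: a Boolean algebra homomorphism that preserves
countable joins (hence also countable meets, by taking complements). -/
structure SigmaHom (A : Type u) (B : Type v) [BooleanAlgebra A] [BooleanAlgebra B] extends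
    BoundedLatticeHom A B where
  map_isLUB' : ∀ (s : ℕ → A) (a : A), IsLUB (range s) a →
    IsLUB (range fun n => toFun (s n)) (toFun a)

namespace SigmaHom

variable {A : Type u} {B : Type v} {C : Type w} [BooleanAlgebra A] [BooleanAlgebra B]
  [BooleanAlgebra C]

instance : FunLike (SigmaHom A B) A B where
  coe f := f.toFun
  coe_injective f g h := by
    cases f; cases g; congr; exact DFunLike.coe_injective h

instance : BoundedLatticeHomClass (SigmaHom A B) A B where
  map_sup f := f.map_sup'
  map_inf f := f.map_inf'
  map_top f := f.map_top'
  map_bot f := f.map_bot'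

@[ext] theorem ext {f g : SigmaHom A B} (h : ∀ a, f a = g a) : f = g := DFunLike.ext _ _ h

theorem map_isLUB (f : SigmaHom A B) {s : ℕ → A} {a : A} (h : IsLUB (range s) a) :
    IsLUB (range fun n => f (s n)) (f a) := f.map_isLUB' s a h

/-- The identity morphism. -/
protected def id (A : Type u) [BooleanAlgebra A] : SigmaHom A A where
  toBoundedLatticeHom := BoundedLatticeHom.id A
  map_isLUB' _ _ h := h

/-- Composition of morphisms. -/
def comp (g : SigmaHom B C) (f : SigmaHom A B) : SigmaHom A C where
  toBoundedLatticeHom := g.toBoundedLatticeHom.comp f.toBoundedLatticeHom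
  map_isLUB' _ _ h := g.map_isLUB (f.map_isLUB h)

@[simp] theorem id_apply (a : A) : SigmaHom.id A a = a := rfl
@[simp] theorem comp_apply (g : SigmaHom B C) (f : SigmaHom A B) (a : A) :
    g.comp f a = g (f a) := rfl

end SigmaHom

/-! ### Sigma-algebras of sets -/

/-- The measurable subsets of a measurable space. -/
abbrev MeasSet (E : Type u) (m : MeasurableSpace E) : Type u := {s : Set E // MeasurableSet[m] s}

section MeasSet

variable {E : Type u} {F : Type v} {m : MeasurableSpace E} {m' : MeasurableSpace F}

instance : BooleanAlgebra (MeasSet E m) := @MeasurableSet.Subtype.instBooleanAlgebra E m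

theorem MeasSet.isLUB_iff (s : ℕ → MeasSet E m) (a : MeasSet E m) :
    IsLUB (range s) a ↔ a.1 = ⋃ n, (s n).1 := by
  have key : IsLUB (range s) ⟨⋃ n, (s n).1, MeasurableSet.iUnion fun n => (s n).2⟩ := by
    constructor
    · rintro _ ⟨n, rfl⟩
      exact subset_iUnion (fun n => (s n).1) n
    · intro b hb
      exact iUnion_subset fun n => hb ⟨n, rfl⟩
  constructor
  · intro h
    exact congrArg Subtype.val (h.unique key)
  · intro h
    have : a = ⟨⋃ n, (s n).1, MeasurableSet.iUnion fun n => (s n).2⟩ := Subtype.ext h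
    rw [this]; exact key

instance : SigmaComplete (MeasSet E m) where
  exists_isLUB s := ⟨⟨⋃ n, (s n).1, MeasurableSet.iUnion fun n => (s n).2⟩,
    (MeasSet.isLUB_iff _ _).2 rfl⟩

/-- The pullback morphism `B ↦ T ⁻¹' B` of a measurable map. -/
def SigmaHom.preimage (T : E → F) (hT : Measurable[m, m'] T) :
    SigmaHom (MeasSet F m') (MeasSet E m) where
  toFun B := ⟨T ⁻¹' B.1, hT B.2⟩
  map_sup' _ _ := rfl
  map_inf' _ _ := rfl
  map_top' := rfl
  map_bot' := rfl
  map_isLUB' s a h := by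
    rw [MeasSet.isLUB_iff] at h ⊢
    exact (congrArg (fun B => T ⁻¹' B) h).trans preimage_iUnion

end MeasSet

/-- The Borel subsets of a topological space. -/
abbrev BorelSet (E : Type u) [TopologicalSpace E] : Type u := MeasSet E (borel E)

/-! ### The Stone space of a Boolean algebra

This is only used below to see that bounded abstractly measurable functions can be added and
multiplied. -/

/-- The space of two-valued homomorphisms on a Boolean algebra. -/
def StoneSp (A : Type u) [BooleanAlgebra A] : Type u :=
  {z : A → Bool // z ⊥ = false ∧ z ⊤ = true ∧
    (∀ a b, z (a ⊔ b) = (z a || z b)) ∧ ∀ a b, z (a ⊓ b) = (z a && z b)}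

namespace StoneSp

variable {A : Type u} [BooleanAlgebra A]

instance : TopologicalSpace (StoneSp A) := inferInstanceAs (TopologicalSpace (Subtype _))
instance : T2Space (StoneSp A) := inferInstanceAs (T2Space (Subtype _))

theorem continuous_apply (a : A) : Continuous fun z : StoneSp A => z.1 a :=
  (_root_.continuous_apply a).comp continuous_subtype_val

instance : CompactSpace (StoneSp A) := by
  refine isCompact_iff_compactSpace.1 (IsClosed.isCompact
    (s := {z : A → Bool | z ⊥ = false ∧ z ⊤ = true ∧
      (∀ a b, z (a ⊔ b) = (z a || z b)) ∧ ∀ a b, z (a ⊓ b) = (z a && z b)}) ?_)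
  have hc : ∀ a : A, Continuous fun z : A → Bool => z a := _root_.continuous_apply
  refine (isClosed_eq (hc _) continuous_const).inter
    ((isClosed_eq (hc _) continuous_const).inter (IsClosed.inter ?_ ?_))
  · change IsClosed {z : A → Bool | ∀ a b, z (a ⊔ b) = (z a || z b)}
    simp only [Set.ofPred_forall]
    refine isClosed_iInter fun a => isClosed_iInter fun b => isClosed_eq (hc _) ?_
    exact (continuous_of_discreteTopology (f := fun p : Bool × Bool => (p.1 || p.2))).comp
      ((hc a).prodMk (hc b))
  · change IsClosed {z : A → Bool | ∀ a b, z (a ⊓ b) = (z a && z b)}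
    simp only [Set.ofPred_forall]
    refine isClosed_iInter fun a => isClosed_iInter fun b => isClosed_eq (hc _) ?_
    exact (continuous_of_discreteTopology (f := fun p : Bool × Bool => (p.1 && p.2))).comp
      ((hc a).prodMk (hc b))

/-- The basic clopen set attached to an element of the algebra. -/
def basic (a : A) : Set (StoneSp A) := {z | z.1 a = true}

theorem mem_basic {a : A} {z : StoneSp A} : z ∈ basic a ↔ z.1 a = true := Iff.rfl

theorem basic_bot : basic (⊥ : A) = ∅ := by ext z; simp [basic, z.2.1]
theorem basic_top : basic (⊤ : A) = univ := by ext z; simp [basic, z.2.2.1]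
theorem basic_sup (a b : A) : basic (a ⊔ b) = basic a ∪ basic b := by
  ext z; simp [basic, z.2.2.2.1]
theorem basic_inf (a b : A) : basic (a ⊓ b) = basic a ∩ basic b := by
  ext z; simp [basic, z.2.2.2.2]
theorem basic_compl (a : A) : basic aᶜ = (basic a)ᶜ := by
  have h1 := basic_sup a aᶜ
  have h2 := basic_inf a aᶜ
  rw [sup_compl_eq_top, basic_top] at h1
  rw [inf_compl_eq_bot, basic_bot] at h2
  exact (IsCompl.of_eq h2.symm h1.symm).compl_eq.symm
theorem basic_mono {a b : A} (h : a ≤ b) : basic a ⊆ basic b := by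
  rw [← sup_eq_right.2 h, basic_sup]; exact subset_union_left

theorem isClopen_basic (a : A) : IsClopen (basic a) :=
  (isClopen_discrete {true}).preimage (continuous_apply a)

theorem basic_nonempty {a : A} (ha : a ≠ ⊥) : (basic a).Nonempty := by
  obtain ⟨J, hJ, -, hd⟩ := DistribLattice.prime_ideal_of_disjoint_filter_ideal
    (F := Order.PFilter.principal a) (I := Order.Ideal.principal ⊥) (by
      rw [Set.disjoint_left]
      intro x hx hx'
      have h1 : a ≤ x := hx
      have h2 : x ≤ ⊥ := hx'
      exact ha (le_bot_iff.1 (h1.trans h2)))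
  classical
  have haJ : a ∉ J := fun h => Set.disjoint_left.1 hd (show a ∈ Order.PFilter.principal a from
    le_refl a) h
  have htop : ⊤ ∉ J := fun h => haJ (J.lower le_top h)
  refine ⟨⟨fun x => decide (x ∉ J), ?_, ?_, ?_, ?_⟩, ?_⟩
  · simp
  · simp [htop]
  · intro x y
    rw [← Bool.decide_or, decide_eq_decide, Order.Ideal.sup_mem_iff]
    tauto
  · intro x y
    rw [← Bool.decide_and, decide_eq_decide]
    have : x ⊓ y ∈ J ↔ x ∈ J ∨ y ∈ J :=
      ⟨fun h => hJ.mem_or_mem h, fun h => h.elim (J.lower inf_le_left) (J.lower inf_le_right)⟩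
    tauto
  · exact decide_eq_true haJ

theorem exists_basic_between {K U : Set (StoneSp A)} (hK : IsCompact K) (hU : IsOpen U)
    (h : K ⊆ U) : ∃ a : A, K ⊆ basic a ∧ basic a ⊆ U := by
  suffices H : ∃ a : A, K ⊆ basic a ∧ basic a ⊆ U from H
  have hz : ∀ z ∈ U, ∃ a : A, z ∈ basic a ∧ basic a ⊆ U := by
    intro z hzU
    have : Nonempty {a : A // z ∈ basic a} := ⟨⟨⊤, by rw [basic_top]; trivial⟩⟩
    obtain ⟨⟨a, ha⟩, haU⟩ := exists_subset_nhds_of_isCompact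
      (V := fun a : {a : A // z ∈ basic a} => basic a.1)
      (by
        rintro ⟨a, ha⟩ ⟨b, hb⟩
        exact ⟨⟨a ⊓ b, by rw [basic_inf]; exact ⟨ha, hb⟩⟩, basic_mono inf_le_left,
          basic_mono inf_le_right⟩)
      (fun a => (isClopen_basic a.1).1.isCompact) (U := U) (by
        intro x hx
        have : x = z := by
          apply Subtype.ext
          funext a
          by_cases ha : z ∈ basic a
          · have h1 : x ∈ basic a := mem_iInter.1 hx ⟨a, ha⟩
            rw [mem_basic] at h1 ha
            rw [h1, ha]
          · have h1 : x ∈ basic aᶜ := mem_iInter.1 hx ⟨aᶜ, by rw [basic_compl]; exact ha⟩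
            rw [basic_compl] at h1
            have h2 : ¬ x.1 a = true := h1
            have h3 : ¬ z.1 a = true := ha
            rw [Bool.not_eq_true] at h2 h3
            rw [h2, h3]
        rw [this]
        exact hU.mem_nhds hzU)
    exact ⟨a, ha, haU⟩
  refine hK.induction_on (p := fun s => ∃ a : A, s ⊆ basic a ∧ basic a ⊆ U) ?_ ?_ ?_ ?_
  · exact ⟨⊥, empty_subset _, by rw [basic_bot]; exact empty_subset _⟩
  · rintro s t hst ⟨a, h1, h2⟩
    exact ⟨a, hst.trans h1, h2⟩
  · rintro s t ⟨a, h1, h2⟩ ⟨b, h3, h4⟩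
    refine ⟨a ⊔ b, ?_, ?_⟩
    · rw [basic_sup]; exact union_subset_union h1 h3
    · rw [basic_sup]; exact union_subset h2 h4
  · intro z hzK
    obtain ⟨a, ha, haU⟩ := hz z (h hzK)
    exact ⟨basic a, mem_nhdsWithin_of_mem_nhds ((isClopen_basic a).2.mem_nhds ha), a,
      Subset.rfl, haU⟩

theorem le_of_residual {a b : A} (h : ∀ᶠ z in residual (StoneSp A), z ∈ basic a → z ∈ basic b) :
    a ≤ b := by
  by_contra hab
  have hne : a ⊓ bᶜ ≠ ⊥ := by
    rwa [Ne, ← _root_.sdiff_eq, sdiff_eq_bot_iff]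
  refine not_isMeagre_of_isOpen (isClopen_basic (a ⊓ bᶜ)).2 (basic_nonempty hne) ?_
  filter_upwards [h] with z hz hz'
  rw [basic_inf, basic_compl] at hz'
  exact hz'.2 (hz hz'.1)

theorem eq_of_residualEq {a b : A} (h : basic a =ᵇ basic b) : a = b :=
  le_antisymm (le_of_residual (by filter_upwards [h.mem_iff] with z hz using hz.1))
    (le_of_residual (by filter_upwards [h.mem_iff] with z hz using hz.2))

theorem iUnion_basic_residualEq {s : ℕ → A} {a : A} (h : IsLUB (range s) a) :
    (⋃ n, basic (s n)) =ᵇ basic a := by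
  have ho : IsOpen (⋃ n, basic (s n)) := isOpen_iUnion fun n => (isClopen_basic _).2
  have hcl : closure (⋃ n, basic (s n)) = basic a := by
    apply Subset.antisymm
    · exact closure_minimal (iUnion_subset fun n => basic_mono (h.1 ⟨n, rfl⟩))
        (isClopen_basic a).1
    · intro z hz
      by_contra hzc
      obtain ⟨b, hzb, hb⟩ := exists_basic_between (isCompact_singleton (x := z))
        (isClosed_closure (s := ⋃ n, basic (s n))).isOpen_compl (singleton_subset_iff.2 hzc)
      have hle : a ≤ bᶜ := by
        apply h.2
        rintro _ ⟨n, rfl⟩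
        rw [le_compl_iff_disjoint_right]
        by_contra hnd
        rw [disjoint_iff] at hnd
        obtain ⟨y, hy⟩ := basic_nonempty hnd
        rw [basic_inf] at hy
        exact hb hy.2 (subset_closure (mem_iUnion.2 ⟨n, hy.1⟩))
      have hzb' := basic_mono hle hz
      rw [basic_compl] at hzb'
      exact hzb' (hzb rfl)
  rw [← hcl]
  exact (closure_residualEq ho.isLocallyClosed).symm

end StoneSp

/-! ### Bounded abstractly measurable functions -/

section Pull

open StoneSp

variable {A : Type u} [BooleanAlgebra A]

theorem measurable_continuous {E : Type v} {F : Type w} [TopologicalSpace E] [TopologicalSpace F]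
    (h : C(E, F)) : Measurable[borel E, borel F] h := by
  borelize E F
  exact h.continuous.measurable

/-- The morphism on Borel algebras given by preimages under a continuous map. -/
def borelPreimage {E : Type v} {F : Type w} [TopologicalSpace E] [TopologicalSpace F]
    (h : C(E, F)) : SigmaHom (BorelSet F) (BorelSet E) :=
  SigmaHom.preimage h (measurable_continuous h)

theorem borelSet_induction {E : Type v} [TopologicalSpace E] {P : BorelSet E → Prop}
    (ho : ∀ U : BorelSet E, IsOpen U.1 → P U) (hc : ∀ U, P U → P Uᶜ)
    (hu : ∀ (s : ℕ → BorelSet E) (a : BorelSet E), IsLUB (range s) a → (∀ n, P (s n)) → P a)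
    (B : BorelSet E) : P B := by
  obtain ⟨B, hB⟩ := B
  induction B, hB using MeasurableSpace.generateFrom_induction with
  | hC t ht ht' => exact ho ⟨t, ht'⟩ ht
  | empty => exact ho _ isOpen_empty
  | compl t ht ih => exact hc _ ih
  | iUnion s hs ih =>
    exact hu (fun n => ⟨s n, hs n⟩) _ ((MeasSet.isLUB_iff _ _).2 rfl) ih

theorem SigmaHom.ext_borel {E : Type v} [TopologicalSpace E] {f g : SigmaHom (BorelSet E) A}
    (h : ∀ U : BorelSet E, IsOpen U.1 → f U = g U) : f = g := by
  ext B
  induction B using borelSet_induction with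
  | ho U hU => exact h U hU
  | hc U ih => rw [map_compl', map_compl', ih]
  | hu s a ha ih =>
    have h1 := f.map_isLUB ha
    simp only [ih] at h1
    exact h1.unique (g.map_isLUB ha)

variable [SigmaComplete A]

theorem exists_residualEq_basic {E : Type v} [PseudoEMetricSpace E] (g : C(StoneSp A, E))
    (B : BorelSet E) : ∃ a : A, g ⁻¹' B.1 =ᵇ basic a := by
  induction B using borelSet_induction with
  | ho U hU =>
    obtain ⟨F, hF, hFU, hFe, -⟩ := hU.exists_iUnion_isClosed
    have h1 : ∀ n, ∃ a : A, g ⁻¹' F n ⊆ basic a ∧ basic a ⊆ g ⁻¹' U.1 := fun n =>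
      exists_basic_between ((hF n).preimage g.continuous).isCompact (hU.preimage g.continuous)
        (preimage_mono (hFU n))
    choose s hs hs' using h1
    obtain ⟨a, ha⟩ := SigmaComplete.exists_isLUB s
    refine ⟨a, ?_⟩
    have : g ⁻¹' U.1 = ⋃ n, basic (s n) := by
      apply Subset.antisymm
      · rw [← hFe, preimage_iUnion]
        exact iUnion_mono hs
      · exact iUnion_subset hs'
    rw [this]
    exact iUnion_basic_residualEq ha
  | hc U ih =>
    obtain ⟨a, ha⟩ := ih
    exact ⟨aᶜ, by rw [basic_compl]; exact ha.compl⟩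
  | hu s b hb ih =>
    choose t ht using ih
    obtain ⟨a, ha⟩ := SigmaComplete.exists_isLUB t
    refine ⟨a, ?_⟩
    rw [(MeasSet.isLUB_iff _ _).1 hb, preimage_iUnion]
    exact (Filter.EventuallyEq.countable_iUnion ht).trans (iUnion_basic_residualEq ha)

/-- The element of the algebra that agrees with `g ⁻¹' B` up to a meager set. -/
def pullFun {E : Type v} [PseudoEMetricSpace E] (g : C(StoneSp A, E)) (B : BorelSet E) : A :=
  (exists_residualEq_basic g B).choose

theorem pullFun_spec {E : Type v} [PseudoEMetricSpace E] (g : C(StoneSp A, E)) (B : BorelSet E) :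
    g ⁻¹' B.1 =ᵇ basic (pullFun g B) := (exists_residualEq_basic g B).choose_spec

theorem pullFun_eq {E : Type v} [PseudoEMetricSpace E] {g : C(StoneSp A, E)} {B : BorelSet E}
    {a : A} (h : g ⁻¹' B.1 =ᵇ basic a) : pullFun g B = a :=
  eq_of_residualEq ((pullFun_spec g B).symm.trans h)

/-- The morphism from Borel sets to the algebra induced by a continuous function on the Stone
space. -/
def pull {E : Type v} [PseudoEMetricSpace E] (g : C(StoneSp A, E)) : SigmaHom (BorelSet E) A where
  toFun := pullFun g
  map_sup' B C := pullFun_eq <| by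
    rw [basic_sup]; exact (pullFun_spec g B).union (pullFun_spec g C)
  map_inf' B C := pullFun_eq <| by
    rw [basic_inf]; exact (pullFun_spec g B).inter (pullFun_spec g C)
  map_top' := pullFun_eq <| by rw [basic_top]; exact Filter.EventuallyEq.rfl
  map_bot' := pullFun_eq <| by rw [basic_bot]; exact Filter.EventuallyEq.rfl
  map_isLUB' s b hb := by
    obtain ⟨a, ha⟩ := SigmaComplete.exists_isLUB fun n => pullFun g (s n)
    have : pullFun g b = a := pullFun_eq <| by
      rw [(MeasSet.isLUB_iff _ _).1 hb, preimage_iUnion]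
      exact (Filter.EventuallyEq.countable_iUnion fun n => pullFun_spec g (s n)).trans
        (iUnion_basic_residualEq ha)
    simpa only [this] using ha

theorem pull_eq {E : Type v} [PseudoEMetricSpace E] {g : C(StoneSp A, E)} {B : BorelSet E}
    {a : A} (h : g ⁻¹' B.1 =ᵇ basic a) : pull g B = a := pullFun_eq h

theorem pull_eq' {E : Type v} [PseudoEMetricSpace E] {g : C(StoneSp A, E)} {B : BorelSet E}
    {a : A} (h : g ⁻¹' B.1 = basic a) : pull g B = a := pullFun_eq (by rw [h]; exact Filter.EventuallyEq.rfl)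

theorem pull_comp {E : Type v} {F : Type w} [PseudoEMetricSpace E] [PseudoEMetricSpace F]
    (g : C(StoneSp A, E)) (h : C(E, F)) :
    (pull g).comp (borelPreimage h) = pull (h.comp g) := by
  ext B
  exact (pull_eq (pullFun_spec g (borelPreimage h B))).symm

end Pull

/-- The Borel set `{z | ‖z‖ ≤ M}` of complex numbers. -/
def closedDisc (M : ℝ) : BorelSet ℂ :=
  ⟨{z | ‖z‖ ≤ M}, by
    borelize ℂ
    exact measurableSet_le measurable_norm measurable_const⟩

/-- The bounded abstractly measurable functions on an abstract measurable space, with algebra of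
events `A`: the morphisms from the Borel algebra of `ℂ` to `A` (thought of as the preimage maps of
functions to `ℂ`) for which the event "`‖f‖ ≤ M`" is the whole space for some `M`. -/
def LInf (A : Type u) [BooleanAlgebra A] : Type u :=
  {f : SigmaHom (BorelSet ℂ) A // ∃ M : ℝ, f (closedDisc M) = ⊤}

namespace LInf

open StoneSp

section Hat

variable {A : Type u} [BooleanAlgebra A]

instance : CoeFun (LInf A) fun _ => BorelSet ℂ → A := ⟨fun f => f.1⟩

theorem exists_hat (f : LInf A) (z : StoneSp A) :
    ∃ w : ℂ, ∀ U : BorelSet ℂ, IsOpen U.1 → w ∈ U.1 → z ∈ basic (f.1 U) := by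
  obtain ⟨M, hM⟩ := f.2
  by_contra! hcon
  choose U hU hw hz using hcon
  have hK : IsCompact (closedDisc M).1 := by
    have : (closedDisc M).1 = Metric.closedBall 0 M := by ext; simp [closedDisc]
    rw [this]; exact isCompact_closedBall 0 M
  obtain ⟨B, hB, hzB⟩ : ∃ B : BorelSet ℂ, (closedDisc M).1 ⊆ B.1 ∧ z ∉ basic (f.1 B) := by
    refine hK.induction_on (p := fun s => ∃ B : BorelSet ℂ, s ⊆ B.1 ∧ z ∉ basic (f.1 B))
      ?_ ?_ ?_ ?_
    · exact ⟨⊥, empty_subset _, by rw [map_bot, basic_bot]; exact notMem_empty _⟩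
    · rintro s t hst ⟨B, h1, h2⟩
      exact ⟨B, hst.trans h1, h2⟩
    · rintro s t ⟨B, h1, h2⟩ ⟨C, h3, h4⟩
      refine ⟨B ⊔ C, union_subset_union h1 h3, ?_⟩
      rw [map_sup, basic_sup]
      exact fun h => h.elim h2 h4
    · intro w _
      exact ⟨(U w).1, mem_nhdsWithin_of_mem_nhds ((hU w).mem_nhds (hw w)), U w, Subset.rfl, hz w⟩
  apply hzB
  have h1 : f.1 (closedDisc M) ≤ f.1 B := OrderHomClass.mono f.1 hB
  rw [hM, top_le_iff] at h1
  rw [h1, basic_top]; trivial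

/-- The value of `f` at a point of the Stone space. -/
def hatFun (f : LInf A) (z : StoneSp A) : ℂ := (exists_hat f z).choose

theorem mem_basic_of_open (f : LInf A) {z : StoneSp A} {U : BorelSet ℂ} (hU : IsOpen U.1)
    (h : hatFun f z ∈ U.1) : z ∈ basic (f.1 U) := (exists_hat f z).choose_spec U hU h

theorem hatFun_mem_of_closed (f : LInf A) {z : StoneSp A} {B : BorelSet ℂ} (hB : IsClosed B.1)
    (h : z ∈ basic (f.1 B)) : hatFun f z ∈ B.1 := by
  by_contra hn
  have h1 : z ∈ basic (f.1 Bᶜ) := mem_basic_of_open f (U := Bᶜ) hB.isOpen_compl hn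
  rw [map_compl', basic_compl] at h1
  exact h1 h

/-- An open ball, as a Borel set. -/
def ballSet (w : ℂ) (r : ℝ) : BorelSet ℂ :=
  ⟨Metric.ball w r, by borelize ℂ; exact measurableSet_ball⟩

/-- A closed ball, as a Borel set. -/
def cballSet (w : ℂ) (r : ℝ) : BorelSet ℂ :=
  ⟨Metric.closedBall w r, by borelize ℂ; exact measurableSet_closedBall⟩

/-- A bounded abstractly measurable function, as a continuous function on the Stone space. -/
def hat (f : LInf A) : C(StoneSp A, ℂ) where
  toFun := hatFun f
  continuous_toFun := by
    rw [continuous_iff_continuousAt]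
    intro z
    rw [ContinuousAt, Metric.tendsto_nhds]
    intro ε hε
    set U : BorelSet ℂ := ballSet (hatFun f z) (ε / 2)
    have hz : z ∈ basic (f.1 U) :=
      mem_basic_of_open f Metric.isOpen_ball (Metric.mem_ball_self (half_pos hε))
    filter_upwards [(isClopen_basic (f.1 U)).2.mem_nhds hz] with y hy
    have h1 : y ∈ basic (f.1 (cballSet (hatFun f z) (ε / 2))) :=
      basic_mono (OrderHomClass.mono f.1 (show U ≤ _ from Metric.ball_subset_closedBall)) hy
    exact lt_of_le_of_lt (hatFun_mem_of_closed f Metric.isClosed_closedBall h1) (half_lt_self hε)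

theorem hat_mem_of_closed (f : LInf A) {z : StoneSp A} {B : BorelSet ℂ} (hB : IsClosed B.1)
    (h : z ∈ basic (f.1 B)) : hat f z ∈ B.1 := hatFun_mem_of_closed f hB h

variable [SigmaComplete A]

theorem pull_hat (f : LInf A) : pull (hat f) = f.1 := by
  apply SigmaHom.ext_borel
  intro U hU
  obtain ⟨F, hF, hFU, hFe, -⟩ := hU.exists_iUnion_isClosed
  let G : ℕ → BorelSet ℂ := fun n => ⟨F n, by borelize ℂ; exact (hF n).measurableSet⟩
  have hG : IsLUB (range fun n => f.1 (G n)) (f.1 U) :=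
    f.1.map_isLUB ((MeasSet.isLUB_iff _ _).2 hFe.symm)
  have h1 := iUnion_basic_residualEq hG
  refine pull_eq ?_
  have h2 : hat f ⁻¹' U.1 ⊆ basic (f.1 U) := fun z hz => mem_basic_of_open f hU hz
  have h3 : (⋃ n, basic (f.1 (G n))) ⊆ hat f ⁻¹' U.1 :=
    iUnion_subset fun n z hz => hFU n (hatFun_mem_of_closed f (hF n) hz)
  refine Filter.EventuallyLE.antisymm (LE.le.eventuallyLE h2) ?_
  exact h1.symm.le.trans (LE.le.eventuallyLE h3)

/-- The bounded abstractly measurable function given by a continuous function on the Stone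
space. -/
def ofCont (g : C(StoneSp A, ℂ)) : LInf A :=
  ⟨pull g, ‖g‖, pull_eq' (by
    rw [basic_top, eq_univ_iff_forall]
    exact fun z => g.norm_coe_le_norm z)⟩

theorem hat_ofCont (g : C(StoneSp A, ℂ)) : hat (ofCont g) = g := by
  ext z
  rw [← dist_le_zero]
  refine le_of_forall_pos_le_add fun ε hε => ?_
  rw [zero_add]
  obtain ⟨a, ha, hag⟩ := exists_basic_between (isCompact_singleton (x := z))
    (Metric.isOpen_ball.preimage g.continuous)
    (singleton_subset_iff.2 (show g z ∈ Metric.ball (g z) ε from Metric.mem_ball_self hε))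
  refine hat_mem_of_closed (ofCont g) (B := cballSet (g z) ε) Metric.isClosed_closedBall ?_
  have h1 : a ≤ pull g (cballSet (g z) ε) := by
    refine le_of_residual ?_
    filter_upwards [(pullFun_spec g (cballSet (g z) ε)).mem_iff] with y hy hya
    exact hy.1 (Metric.ball_subset_closedBall (hag hya))
  exact basic_mono h1 (ha rfl)

theorem ofCont_hat (f : LInf A) : ofCont (hat f) = f := Subtype.ext (pull_hat f)

theorem hat_injective : Function.Injective (hat : LInf A → C(StoneSp A, ℂ)) :=
  Function.LeftInverse.injective ofCont_hat

/-! The algebraic operations are the "conditional" ones: to apply a continuous binary operation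
`ℂ × ℂ → ℂ` to `f` and `g`, one composes it with the joint morphism `(f, g)` to `ℂ × ℂ`, which is
determined by its two coordinates `f` and `g`. -/

/-- The joint morphism `(f, g)` to `ℂ × ℂ` of two bounded abstractly measurable functions. -/
def joint (f g : LInf A) : SigmaHom (BorelSet (ℂ × ℂ)) A := pull ((hat f).prodMk (hat g))

theorem joint_fst (f g : LInf A) :
    (joint f g).comp (borelPreimage ⟨Prod.fst, continuous_fst⟩) = f.1 := by
  rw [joint, pull_comp, ← pull_hat f]; rfl

theorem joint_snd (f g : LInf A) :
    (joint f g).comp (borelPreimage ⟨Prod.snd, continuous_snd⟩) = g.1 := by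
  rw [joint, pull_comp, ← pull_hat g]; rfl

/-- Composition `h ∘ f` of a bounded abstractly measurable function with a continuous function. -/
def map (h : C(ℂ, ℂ)) (f : LInf A) : LInf A :=
  ⟨f.1.comp (borelPreimage h), by
    rw [← pull_hat f, pull_comp]; exact (ofCont (h.comp (hat f))).2⟩

theorem hat_map (h : C(ℂ, ℂ)) (f : LInf A) : hat (map h f) = h.comp (hat f) := by
  rw [← hat_ofCont (h.comp (hat f))]
  congr 1
  apply Subtype.ext
  change f.1.comp (borelPreimage h) = pull (h.comp (hat f))
  rw [← pull_comp, pull_hat]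

/-- Composition `h ∘ (f, g)` of a pair of bounded abstractly measurable functions with a
continuous function of two variables. -/
def map₂ (h : C(ℂ × ℂ, ℂ)) (f g : LInf A) : LInf A :=
  ⟨(joint f g).comp (borelPreimage h), by
    rw [joint, pull_comp]; exact (ofCont (h.comp ((hat f).prodMk (hat g)))).2⟩

theorem hat_map₂ (h : C(ℂ × ℂ, ℂ)) (f g : LInf A) :
    hat (map₂ h f g) = h.comp ((hat f).prodMk (hat g)) := by
  rw [← hat_ofCont (h.comp ((hat f).prodMk (hat g)))]
  exact congrArg hat (Subtype.ext (pull_comp _ h))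

end Hat

section Indicator

variable {A : Type u} [BooleanAlgebra A]

open Classical in
/-- The morphism underlying the indicator function `1_E` of an event: the preimage of `B` is `E`,
`Eᶜ`, everything or nothing according to which of `1` and `0` lie in `B`. -/
def indHom (E : A) : SigmaHom (BorelSet ℂ) A where
  toFun B := (if (1 : ℂ) ∈ B.1 then E else ⊥) ⊔ (if (0 : ℂ) ∈ B.1 then Eᶜ else ⊥)
  map_sup' B C := by
    have h (w : ℂ) : w ∈ (B ⊔ C).1 ↔ w ∈ B.1 ∨ w ∈ C.1 := Iff.rfl
    simp only [h]
    by_cases h1 : (1 : ℂ) ∈ B.1 <;> by_cases h2 : (1 : ℂ) ∈ C.1 <;>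
    by_cases h3 : (0 : ℂ) ∈ B.1 <;> by_cases h4 : (0 : ℂ) ∈ C.1 <;> simp [h1, h2, h3, h4]
  map_inf' B C := by
    have h (w : ℂ) : w ∈ (B ⊓ C).1 ↔ w ∈ B.1 ∧ w ∈ C.1 := Iff.rfl
    simp only [h]
    by_cases h1 : (1 : ℂ) ∈ B.1 <;> by_cases h2 : (1 : ℂ) ∈ C.1 <;>
    by_cases h3 : (0 : ℂ) ∈ B.1 <;> by_cases h4 : (0 : ℂ) ∈ C.1 <;> simp [h1, h2, h3, h4]
  map_top' := by simp
  map_bot' := by simp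
  map_isLUB' s a ha := by
    rw [MeasSet.isLUB_iff] at ha
    simp only [ha, mem_iUnion]
    constructor
    · rintro _ ⟨n, rfl⟩
      refine sup_le_sup ?_ ?_ <;> split_ifs with h1 h2
      all_goals first | exact le_rfl | exact bot_le | exact (h2 ⟨n, h1⟩).elim
    · intro c hc
      refine sup_le ?_ ?_
      · split_ifs with h
        · obtain ⟨n, hn⟩ := h
          refine le_trans ?_ (hc ⟨n, rfl⟩)
          simp [hn]
        · exact bot_le
      · split_ifs with h
        · obtain ⟨n, hn⟩ := h
          refine le_trans ?_ (hc ⟨n, rfl⟩)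
          simp [hn]
        · exact bot_le

open Classical in
theorem indHom_apply (E : A) (B : BorelSet ℂ) :
    indHom E B = (if (1 : ℂ) ∈ B.1 then E else ⊥) ⊔ (if (0 : ℂ) ∈ B.1 then Eᶜ else ⊥) := rfl

/-- The indicator function `1_E` of an event. -/
def ind (E : A) : LInf A := ⟨indHom E, 1, by
  rw [indHom_apply, if_pos (show (1 : ℂ) ∈ (closedDisc 1).1 by simp [closedDisc]), if_pos (show (0 : ℂ) ∈ (closedDisc 1).1 by simp [closedDisc]),
    sup_compl_eq_top]⟩

theorem hat_ind (E : A) (z : StoneSp A) [Decidable (z ∈ basic E)] :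
    hat (ind E) z = if z ∈ basic E then 1 else 0 := by
  have key : ∀ w : ℂ, z ∈ basic (indHom E (cballSet w 0)) → hat (ind E) z = w := fun w hw =>
    dist_le_zero.1 (hat_mem_of_closed (ind E) (B := cballSet w 0) Metric.isClosed_closedBall hw)
  split_ifs with h
  · refine key 1 ?_
    rw [indHom_apply, if_pos (show (1 : ℂ) ∈ (cballSet 1 0).1 by simp [cballSet]),
      if_neg (show (0 : ℂ) ∉ (cballSet 1 0).1 by simp [cballSet]), sup_bot_eq]
    exact h
  · refine key 0 ?_
    rw [indHom_apply, if_neg (show (1 : ℂ) ∉ (cballSet 0 0).1 by simp [cballSet]),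
      if_pos (show (0 : ℂ) ∈ (cballSet 0 0).1 by simp [cballSet]), bot_sup_eq, basic_compl]
    exact h

end Indicator

section Algebra

variable {A : Type u} [BooleanAlgebra A]

instance : Zero (LInf A) := ⟨ind ⊥⟩
instance : One (LInf A) := ⟨ind ⊤⟩

/-- The norm is the least `M` with `‖f‖ ≤ M`. -/
instance : Norm (LInf A) := ⟨fun f => sInf {M : ℝ | 0 ≤ M ∧ f (closedDisc M) = ⊤}⟩

theorem norm_def (f : LInf A) : ‖f‖ = sInf {M : ℝ | 0 ≤ M ∧ f (closedDisc M) = ⊤} := rfl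

theorem hat_zero : hat (0 : LInf A) = 0 := by
  classical
  ext z
  refine (hat_ind ⊥ z).trans ?_
  simp [basic_bot]

theorem hat_one : hat (1 : LInf A) = 1 := by
  classical
  ext z
  refine (hat_ind ⊤ z).trans ?_
  simp [basic_top]

variable [SigmaComplete A]

instance : Add (LInf A) := ⟨map₂ ⟨fun p => p.1 + p.2, by fun_prop⟩⟩
instance : Mul (LInf A) := ⟨map₂ ⟨fun p => p.1 * p.2, by fun_prop⟩⟩
instance : Sub (LInf A) := ⟨map₂ ⟨fun p => p.1 - p.2, by fun_prop⟩⟩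
instance : Neg (LInf A) := ⟨map ⟨fun z => -z, by fun_prop⟩⟩
instance : Star (LInf A) := ⟨map ⟨fun z => star z, by fun_prop⟩⟩
instance : SMul ℂ (LInf A) := ⟨fun c => map ⟨fun z => c * z, by fun_prop⟩⟩
instance : SMul ℕ (LInf A) := ⟨fun n => map ⟨fun z => n * z, by fun_prop⟩⟩
instance : SMul ℤ (LInf A) := ⟨fun n => map ⟨fun z => n * z, by fun_prop⟩⟩
instance : Pow (LInf A) ℕ := ⟨fun f n => map ⟨fun z => z ^ n, by fun_prop⟩ f⟩
instance : NatCast (LInf A) := ⟨fun n => (n : ℂ) • 1⟩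
instance : IntCast (LInf A) := ⟨fun n => (n : ℂ) • 1⟩

theorem hat_add (f g : LInf A) : hat (f + g) = hat f + hat g := hat_map₂ _ f g
theorem hat_mul (f g : LInf A) : hat (f * g) = hat f * hat g := hat_map₂ _ f g
theorem hat_sub (f g : LInf A) : hat (f - g) = hat f - hat g := hat_map₂ _ f g
theorem hat_neg (f : LInf A) : hat (-f) = -hat f := hat_map _ f
theorem hat_star (f : LInf A) : hat (star f) = star (hat f) := hat_map _ f
theorem hat_smul (c : ℂ) (f : LInf A) : hat (c • f) = c • hat f := hat_map _ f
theorem hat_nsmul (n : ℕ) (f : LInf A) : hat (n • f) = n • hat f :=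
  (hat_map _ f).trans (by ext z; simp)
theorem hat_zsmul (n : ℤ) (f : LInf A) : hat (n • f) = n • hat f :=
  (hat_map _ f).trans (by ext z; simp)
theorem hat_pow (f : LInf A) (n : ℕ) : hat (f ^ n) = hat f ^ n :=
  (hat_map _ f).trans (by ext z; simp)
theorem hat_natCast (n : ℕ) : hat (n : LInf A) = n :=
  (hat_smul _ _).trans (by rw [hat_one]; ext z; simp)
theorem hat_intCast (n : ℤ) : hat (n : LInf A) = n :=
  (hat_smul _ _).trans (by rw [hat_one]; ext z; simp)

instance : CommRing (LInf A) :=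
  hat_injective.commRing hat hat_zero hat_one hat_add hat_mul hat_neg hat_sub hat_nsmul hat_zsmul
    hat_pow hat_natCast hat_intCast

theorem closedDisc_eq_top_iff (f : LInf A) (M : ℝ) :
    f (closedDisc M) = ⊤ ↔ ∀ z, ‖hat f z‖ ≤ M := by
  constructor
  · intro h z
    refine hat_mem_of_closed f (B := closedDisc M) (z := z)
      (isClosed_le continuous_norm continuous_const) ?_
    rw [h, basic_top]; trivial
  · intro h
    rw [← pull_hat f]
    exact pull_eq' (by rw [basic_top, eq_univ_iff_forall]; exact h)

theorem norm_hat (f : LInf A) : ‖hat f‖ = ‖f‖ := by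
  rw [norm_def]
  simp only [closedDisc_eq_top_iff]
  have h : IsLeast {M : ℝ | 0 ≤ M ∧ ∀ z, ‖hat f z‖ ≤ M} ‖hat f‖ :=
    ⟨⟨norm_nonneg _, (hat f).norm_coe_le_norm⟩, fun M hM =>
      (ContinuousMap.norm_le _ hM.1).2 hM.2⟩
  exact h.csInf_eq.symm

instance : NormedCommRing (LInf A) where
  toMetricSpace := MetricSpace.induced hat hat_injective inferInstance
  dist_eq f g := by
    rw [← norm_hat, hat_add, hat_neg]
    exact dist_eq_norm_neg_add (hat f) (hat g)
  norm_mul_le f g := by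
    simp only [← norm_hat, hat_mul]
    exact norm_mul_le _ _
  mul_comm := mul_comm

theorem isometry_hat : Isometry (hat : LInf A → C(StoneSp A, ℂ)) := fun _ _ => rfl

instance : CompleteSpace (LInf A) := by
  refine (isometry_hat.isUniformInducing).completeSpace ?_
  have : range (hat : LInf A → C(StoneSp A, ℂ)) = univ :=
    range_eq_univ.2 fun g => ⟨ofCont g, hat_ofCont g⟩
  rw [this]
  exact isComplete_univ

instance : StarRing (LInf A) where
  star_involutive f := hat_injective (by simp only [hat_star, star_star])
  star_mul f g := hat_injective (by simp only [hat_star, hat_mul, star_mul])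
  star_add f g := hat_injective (by simp only [hat_star, hat_add, star_add])

instance : CStarRing (LInf A) where
  norm_mul_self_le f := by
    simp only [← norm_hat, hat_mul, hat_star]
    exact CStarRing.norm_mul_self_le _

instance : Module ℂ (LInf A) :=
  Function.Injective.module ℂ ⟨⟨hat, hat_zero⟩, hat_add⟩ hat_injective hat_smul

instance : Algebra ℂ (LInf A) :=
  Algebra.ofModule (fun c f g => hat_injective (by simp only [hat_smul, hat_mul, smul_mul_assoc]))
    (fun c f g => hat_injective (by simp only [hat_smul, hat_mul, mul_smul_comm]))

instance : NormedAlgebra ℂ (LInf A) where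
  norm_smul_le c f := by
    simp only [← norm_hat, hat_smul]
    exact norm_smul_le _ _

instance : StarModule ℂ (LInf A) where
  star_smul c f := hat_injective (by simp only [hat_smul, hat_star, star_smul])

instance : CommCStarAlgebra (LInf A) where

end Algebra

end LInf

/-! ### Probability measures on abstract algebras of events -/

/-- A (countably additive) probability measure on a Boolean algebra. (Additivity forces it to be
monotone, so its values lie in `[0,1]`.) -/
structure ProbMeas (A : Type u) [BooleanAlgebra A] where
  toFun : A → ℝ≥0∞
  map_bot' : toFun ⊥ = 0
  map_top' : toFun ⊤ = 1
  map_isLUB' : ∀ (s : ℕ → A) (a : A), Pairwise (fun m n => s m ⊓ s n = ⊥) → IsLUB (range s) a →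
    toFun a = ∑' n, toFun (s n)

instance {A : Type u} [BooleanAlgebra A] : CoeFun (ProbMeas A) fun _ => A → ℝ≥0∞ :=
  ⟨ProbMeas.toFun⟩

section Law

/-- A measurable subset of a Borel space, as a Borel set. -/
def toBorel {E : Type v} [TopologicalSpace E] [MeasurableSpace E] [BorelSpace E] (B : Set E)
    (hB : MeasurableSet B) : BorelSet E :=
  ⟨B, by rwa [← BorelSpace.measurable_eq (α := E)]⟩

variable {A : Type u} [BooleanAlgebra A] (μ : ProbMeas A)

/-- The law of an abstractly measurable function with values in `E`: the pushforward of the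
probability measure to `E`. -/
def law {E : Type v} [TopologicalSpace E] [MeasurableSpace E] [BorelSpace E]
    (J : SigmaHom (BorelSet E) A) : Measure E :=
  Measure.ofMeasurable (fun B hB => μ (J (toBorel B hB)))
    ((congrArg μ (map_bot J)).trans μ.map_bot') (by
      intro s hs hd
      refine μ.map_isLUB' (fun n => J (toBorel (s n) (hs n))) _ ?_ (J.map_isLUB ((MeasSet.isLUB_iff _ _).2 rfl))
      intro m n hmn
      rw [← map_inf, ← map_bot J]
      exact congrArg J (Subtype.ext (Set.disjoint_iff_inter_eq_empty.1 (hd hmn))))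

variable {E : Type v} [TopologicalSpace E] [MeasurableSpace E] [BorelSpace E]

theorem law_apply (J : SigmaHom (BorelSet E) A) (B : Set E) (hB : MeasurableSet B) :
    law μ J B = μ (J (toBorel B hB)) := Measure.ofMeasurable_apply B hB

instance (J : SigmaHom (BorelSet E) A) : IsProbabilityMeasure (law μ J) where
  measure_univ := by
    rw [law_apply μ J univ .univ]
    exact (congrArg μ (map_top J)).trans μ.map_top'

theorem law_map {F : Type w} [TopologicalSpace F] [MeasurableSpace F] [BorelSpace F]
    (J : SigmaHom (BorelSet E) A) (h : C(E, F)) :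
    (law μ J).map h = law μ (J.comp (borelPreimage h)) := by
  ext B hB
  rw [Measure.map_apply h.continuous.measurable hB, law_apply _ _ _ hB,
    law_apply _ _ _ (h.continuous.measurable hB)]
  rfl

/-- The trace (integral) of a bounded abstractly measurable function: the mean of its law. -/
def trace (f : LInf A) : ℂ := ∫ z, z ∂(law μ f.1)

open LInf

variable [SigmaComplete A]

theorem trace_ofCont {E : Type} [PseudoEMetricSpace E] [MeasurableSpace E] [BorelSpace E]
    (g : C(StoneSp A, E)) (h : C(E, ℂ)) :
    trace μ (ofCont (h.comp g)) = ∫ p, h p ∂(law μ (pull g)) := by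
  have h1 : (ofCont (h.comp g)).1 = (pull g).comp (borelPreimage h) := (pull_comp g h).symm
  rw [trace, h1, ← law_map, integral_map h.continuous.measurable.aemeasurable]
  exact aestronglyMeasurable_id

theorem integrable_law {E : Type} [PseudoEMetricSpace E] [MeasurableSpace E] [BorelSpace E]
    (g : C(StoneSp A, E)) (h : C(E, ℂ)) : Integrable h (law μ (pull g)) := by
  have hm : MeasurableSet {p : E | ‖h p‖ ≤ ‖h.comp g‖} :=
    (isClosed_le h.continuous.norm continuous_const).measurableSet
  refine Integrable.of_bound h.continuous.measurable.aestronglyMeasurable ‖h.comp g‖ ?_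
  rw [ae_iff_prob_eq_one (p := fun p => ‖h p‖ ≤ ‖h.comp g‖)]
  · rw [law_apply μ _ _ hm, ← μ.map_top']
    refine congrArg μ (pull_eq' ?_)
    rw [StoneSp.basic_top, eq_univ_iff_forall]
    exact fun z => (h.comp g).norm_coe_le_norm z
  · exact measurableSet_setOfPred.1 hm

theorem trace_add (f g : LInf A) : trace μ (f + g) = trace μ f + trace μ g := by
  let J : C(StoneSp A, ℂ × ℂ) := (hat f).prodMk (hat g)
  have h1 : f + g = ofCont ((⟨fun p => p.1 + p.2, by fun_prop⟩ : C(ℂ × ℂ, ℂ)).comp J) :=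
    hat_injective (by rw [hat_ofCont, hat_add]; rfl)
  have h2 : f = ofCont ((⟨Prod.fst, by fun_prop⟩ : C(ℂ × ℂ, ℂ)).comp J) :=
    hat_injective (by rw [hat_ofCont]; rfl)
  have h3 : g = ofCont ((⟨Prod.snd, by fun_prop⟩ : C(ℂ × ℂ, ℂ)).comp J) :=
    hat_injective (by rw [hat_ofCont]; rfl)
  rw [h1]
  conv_rhs => rw [h2, h3]
  rw [trace_ofCont, trace_ofCont, trace_ofCont]
  exact integral_add (integrable_law μ J ⟨Prod.fst, by fun_prop⟩)
    (integrable_law μ J ⟨Prod.snd, by fun_prop⟩)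

theorem trace_smul (c : ℂ) (f : LInf A) : trace μ (c • f) = c * trace μ f := by
  have h1 : c • f = ofCont ((⟨fun z => c * z, by fun_prop⟩ : C(ℂ, ℂ)).comp (hat f)) :=
    hat_injective (by rw [hat_ofCont, hat_smul]; rfl)
  rw [h1, trace_ofCont, pull_hat]
  exact integral_const_mul c _

theorem trace_star_mul_self (f : LInf A) : 0 ≤ (trace μ (star f * f)).re := by
  have h1 : star f * f =
      ofCont ((⟨fun z => ((‖z‖ ^ 2 : ℝ) : ℂ), by fun_prop⟩ : C(ℂ, ℂ)).comp (hat f)) :=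
    hat_injective (by
      rw [hat_ofCont, hat_mul, hat_star]
      ext z
      simp [Complex.conj_mul'])
  rw [h1, trace_ofCont]
  refine le_of_le_of_eq (integral_nonneg fun z => sq_nonneg ‖z‖)
    (congrArg Complex.re (integral_ofReal (𝕜 := ℂ) (μ := law μ (pull (hat f)))
      (f := fun z => ‖z‖ ^ 2))).symm

theorem trace_one : trace μ 1 = 1 := by
  have h1 : (1 : LInf A) = ofCont ((⟨fun _ => 1, by fun_prop⟩ : C(ℂ, ℂ)).comp (hat 0)) :=
    hat_injective (by rw [hat_ofCont, hat_one]; rfl)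
  rw [h1, trace_ofCont]
  simp

end Law

/-! ### The Baire `σ`-algebra -/

/-- The Baire `σ`-algebra, generated by the continuous complex-valued functions. -/
abbrev baire (S : Type u) [TopologicalSpace S] : MeasurableSpace S :=
  ⨆ f : C(S, ℂ), (borel ℂ).comap f

theorem baire_le_borel (S : Type u) [TopologicalSpace S] : baire S ≤ borel S :=
  iSup_le fun f => (measurable_continuous f).comap_le

theorem measurable_baire {S : Type u} {T : Type v} [TopologicalSpace S] [TopologicalSpace T]
    (h : C(S, T)) : Measurable[baire S, baire T] h := by
  rw [measurable_iff_comap_le, baire, MeasurableSpace.comap_iSup]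
  refine iSup_le fun f => ?_
  rw [MeasurableSpace.comap_comp]
  exact le_iSup (fun f : C(S, ℂ) => (borel ℂ).comap f) (f.comp h)

/-! ### The Gelfand spectrum of the algebra of bounded functions, and its Riesz measure -/

section Spectrum

variable {A : Type u} [BooleanAlgebra A] [SigmaComplete A]

/-- The Gelfand spectrum of the `C⋆`-algebra of bounded abstractly measurable functions, with the
topology of pointwise convergence. -/
abbrev Spec (A : Type u) [BooleanAlgebra A] [SigmaComplete A] : Type u :=
  WeakDual.characterSpace ℂ (LInf A)

/-- The element of the algebra whose Gelfand transform is a given real continuous function. -/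
def gelfandInv (g : C(Spec A, ℝ)) : LInf A :=
  (gelfandStarTransform (LInf A)).symm ⟨fun χ => (g χ : ℂ), by fun_prop⟩

theorem gelfandInv_add (g h : C(Spec A, ℝ)) :
    gelfandInv (g + h) = gelfandInv g + gelfandInv h := by
  rw [gelfandInv, gelfandInv, gelfandInv, ← map_add]
  congr 1
  ext χ
  simp

theorem gelfandInv_smul (c : ℝ) (g : C(Spec A, ℝ)) :
    gelfandInv (c • g) = (c : ℂ) • gelfandInv g := by
  rw [gelfandInv, gelfandInv, ← map_smul]
  congr 1
  ext χ
  simp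

theorem gelfandInv_mul (g h : C(Spec A, ℝ)) :
    gelfandInv (g * h) = gelfandInv g * gelfandInv h := by
  rw [gelfandInv, gelfandInv, gelfandInv, ← map_mul]
  congr 1
  ext χ
  simp

theorem gelfandInv_star (g : C(Spec A, ℝ)) : star (gelfandInv g) = gelfandInv g := by
  rw [gelfandInv, ← map_star]
  congr 1
  ext χ
  simp

theorem gelfandInv_one : gelfandInv (1 : C(Spec A, ℝ)) = 1 := by
  rw [gelfandInv, ← map_one (gelfandStarTransform (LInf A)).symm]
  congr 1

variable (μ : ProbMeas A)

open scoped CompactlySupported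

/-- The trace, as a positive linear functional on the continuous functions on the spectrum, by way
of the Gelfand isomorphism. -/
def spectralFunctional : C_c(Spec A, ℝ) →ₚ[ℝ] ℝ :=
  PositiveLinearMap.mk₀
    { toFun := fun g => (trace μ (gelfandInv g.toContinuousMap)).re
      map_add' := fun g h => by
        rw [← Complex.add_re, ← trace_add, ← gelfandInv_add]; rfl
      map_smul' := fun c g => by
        have : gelfandInv (c • g).toContinuousMap = (c : ℂ) • gelfandInv g.toContinuousMap := by
          rw [← gelfandInv_smul]; rfl
        rw [this, trace_smul, Complex.re_ofReal_mul]; rfl }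
    (fun g hg => by
      let r : C(Spec A, ℝ) := ⟨fun χ => √(g χ), by fun_prop⟩
      have h1 : g.toContinuousMap = r * r := by
        ext χ
        exact (Real.mul_self_sqrt (hg χ)).symm
      change 0 ≤ (trace μ (gelfandInv g.toContinuousMap)).re
      rw [h1, gelfandInv_mul]
      conv_rhs => enter [1, 2, 1]; rw [← gelfandInv_star]
      exact trace_star_mul_self μ _)

/-- The Borel measure on the spectrum that represents the trace, by the Riesz representation
theorem. -/
def rieszBorel : @Measure (Spec A) (borel (Spec A)) :=
  @RealRMK.rieszMeasure (Spec A) _ _ (borel (Spec A)) (@BorelSpace.mk _ _ (borel _) rfl)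
    (spectralFunctional μ) _

/-- The Baire measure on the spectrum that represents the trace. -/
def rieszBaire : @Measure (Spec A) (baire (Spec A)) :=
  (rieszBorel μ).trim (baire_le_borel _)

theorem rieszMeasure_univ {S : Type u} [TopologicalSpace S] [CompactSpace S] [T2Space S]
    [MeasurableSpace S] [BorelSpace S] (Λ : C_c(S, ℝ) →ₚ[ℝ] ℝ)
    (h : Λ (CompactlySupportedContinuousMap.continuousMapEquiv 1) = 1) :
    RealRMK.rieszMeasure Λ univ = 1 := by
  have h1 := RealRMK.integral_rieszMeasure Λ
    (CompactlySupportedContinuousMap.continuousMapEquiv 1)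
  rw [h] at h1
  have h2 : (RealRMK.rieszMeasure Λ).real univ = 1 := by simpa using h1
  rw [measureReal_def] at h2
  exact (ENNReal.toReal_eq_one_iff _).1 h2

theorem rieszBaire_prob : @IsProbabilityMeasure (Spec A) (baire _) (rieszBaire μ) := by
  have h : rieszBorel μ univ = 1 := by
    refine @rieszMeasure_univ (Spec A) _ _ _ (borel (Spec A)) (@BorelSpace.mk _ _ (borel _) rfl)
      (spectralFunctional μ) ?_
    change (trace μ (gelfandInv 1)).re = 1
    rw [gelfandInv_one, trace_one, Complex.one_re]
  refine @IsProbabilityMeasure.mk _ (baire _) _ ?_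
  rw [rieszBaire, trim_measurableSet_eq _ MeasurableSet.univ, h]

end Spectrum

/-! ### Deleting the null sets -/

namespace ProbMeas

variable {A : Type u} [BooleanAlgebra A] (μ : ProbMeas A)

theorem map_sup_disjoint {a b : A} (h : a ⊓ b = ⊥) : μ (a ⊔ b) = μ a + μ b := by
  let s : ℕ → A := fun n => if n = 0 then a else if n = 1 then b else ⊥
  have h1 : IsLUB (range s) (a ⊔ b) := by
    constructor
    · rintro _ ⟨n, rfl⟩
      simp only [s]
      split_ifs
      exacts [le_sup_left, le_sup_right, bot_le]
    · intro c hc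
      exact sup_le (hc ⟨0, rfl⟩) (hc ⟨1, rfl⟩)
  have h2 : Pairwise fun m n => s m ⊓ s n = ⊥ := by
    intro m n hmn
    simp only [s]
    split_ifs <;> simp_all [inf_comm]
  rw [μ.map_isLUB' s _ h2 h1, tsum_eq_sum (s := Finset.range 2)]
  · simp [Finset.sum_range_succ, s]
  · intro n hn
    have : s n = ⊥ := by
      simp only [Finset.mem_range, not_lt] at hn
      simp only [s]
      rw [if_neg (by omega), if_neg (by omega)]
    rw [this, μ.map_bot']

theorem mono {a b : A} (h : a ≤ b) : μ a ≤ μ b := by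
  have : b = a ⊔ b \ a := (sup_sdiff_cancel_right h).symm
  rw [this, μ.map_sup_disjoint inf_sdiff_self_right]
  exact le_self_add

theorem null_sup {a b : A} (ha : μ a = 0) (hb : μ b = 0) : μ (a ⊔ b) = 0 := by
  have : a ⊔ b = a ⊔ b \ a := (_root_.sup_sdiff_self_right a b).symm
  rw [this, μ.map_sup_disjoint inf_sdiff_self_right, ha, zero_add]
  exact le_antisymm (hb ▸ μ.mono sdiff_le) bot_le

theorem null_of_le {a b : A} (h : a ≤ b) (hb : μ b = 0) : μ a = 0 :=
  le_antisymm (hb ▸ μ.mono h) bot_le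

theorem isLUB_disjointed {s : ℕ → A} {a : A} (h : IsLUB (range s) a) :
    IsLUB (range (disjointed s)) a := by
  have key : upperBounds (range (disjointed s)) = upperBounds (range s) := by
    ext b
    have h1 := upperBounds_range_partialSups (disjointed s)
    have h2 := upperBounds_range_partialSups s
    rw [partialSups_disjointed] at h1
    rw [← h1, h2]
  rwa [IsLUB, key]

theorem null_isLUB {s : ℕ → A} {a : A} (h : IsLUB (range s) a) (h0 : ∀ n, μ (s n) = 0) :
    μ a = 0 := by
  rw [μ.map_isLUB' (disjointed s) a (fun m n hmn => (disjoint_disjointed s hmn).eq_bot)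
    (isLUB_disjointed h)]
  simp [fun n => μ.null_of_le (disjointed_le s n) (h0 n)]

/-- Equality of events up to a null event. -/
def nullSetoid : Setoid A where
  r a b := μ (symmDiff a b) = 0
  iseqv :=
    { refl := fun a => by rw [symmDiff_self]; exact μ.map_bot'
      symm := fun {a b} h => by rwa [symmDiff_comm]
      trans := fun {a b c} h1 h2 =>
        μ.null_of_le (symmDiff_triangle a b c) (μ.null_sup h1 h2) }

/-- The quotient of the algebra of events by the ideal of null events. -/
def NullQuot : Type u := Quotient μ.nullSetoid

namespace NullQuot

variable {μ}

/-- The class of an event. -/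
def mk (μ : ProbMeas A) (a : A) : NullQuot μ := Quotient.mk μ.nullSetoid a

theorem mk_eq_mk {a b : A} : mk μ a = mk μ b ↔ μ (symmDiff a b) = 0 := Quotient.eq (r := nullSetoid μ)

theorem ind {P : NullQuot μ → Prop} (h : ∀ a, P (mk μ a)) (q : NullQuot μ) : P q :=
  Quotient.ind h q

theorem sdiff_sup_le (a b c d : A) : (a ⊔ c) \ (b ⊔ d) ≤ a \ b ⊔ c \ d := by
  rw [sup_sdiff]
  exact sup_le_sup (sdiff_le_sdiff_left le_sup_left) (sdiff_le_sdiff_left le_sup_right)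

theorem sdiff_inf_le (a b c d : A) : (a ⊓ c) \ (b ⊓ d) ≤ a \ b ⊔ c \ d := by
  rw [sdiff_inf]
  exact sup_le_sup (sdiff_le_sdiff_right inf_le_left) (sdiff_le_sdiff_right inf_le_right)

instance : Max (NullQuot μ) := ⟨Quotient.map₂ (· ⊔ ·) fun a b h c d h' =>
  μ.null_of_le (sup_le ((sdiff_sup_le a b c d).trans (sup_le_sup le_sup_left le_sup_left))
    ((sdiff_sup_le b a d c).trans (sup_le_sup le_sup_right le_sup_right))) (μ.null_sup h h')⟩

instance : Min (NullQuot μ) := ⟨Quotient.map₂ (· ⊓ ·) fun a b h c d h' =>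
  μ.null_of_le (sup_le ((sdiff_inf_le a b c d).trans (sup_le_sup le_sup_left le_sup_left))
    ((sdiff_inf_le b a d c).trans (sup_le_sup le_sup_right le_sup_right))) (μ.null_sup h h')⟩

instance : Compl (NullQuot μ) := ⟨Quotient.map compl fun a b h => by
  change μ (symmDiff aᶜ bᶜ) = 0
  rwa [compl_symmDiff_compl]⟩

instance : Top (NullQuot μ) := ⟨mk μ ⊤⟩
instance : Bot (NullQuot μ) := ⟨mk μ ⊥⟩
instance : LE (NullQuot μ) := ⟨fun p q => p ⊔ q = q⟩

theorem mk_le_mk {a b : A} : mk μ a ≤ mk μ b ↔ μ (a \ b) = 0 := by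
  change mk μ (a ⊔ b) = mk μ b ↔ _
  rw [mk_eq_mk, symmDiff, sup_sdiff_right_self, sdiff_eq_bot_iff.2 le_sup_right, sup_bot_eq]

theorem mk_mono {a b : A} (h : a ≤ b) : mk μ a ≤ mk μ b := by
  rw [mk_le_mk, sdiff_eq_bot_iff.2 h]; exact μ.map_bot'

instance : BooleanAlgebra (NullQuot μ) where
  sup p q := p ⊔ q
  inf p q := p ⊓ q
  le_refl p := by induction p using ind; exact mk_mono le_rfl
  le_trans p q r := by
    induction p using ind; induction q using ind; induction r using ind
    intro h1 h2
    rw [mk_le_mk] at h1 h2 ⊢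
    exact μ.null_of_le (sdiff_triangle _ _ _) (μ.null_sup h1 h2)
  le_antisymm p q := by
    induction p using ind; induction q using ind
    intro h1 h2
    rw [mk_le_mk] at h1 h2
    exact mk_eq_mk.2 (μ.null_sup h1 h2)
  le_sup_left p q := by
    induction p using ind; induction q using ind; exact mk_mono le_sup_left
  le_sup_right p q := by
    induction p using ind; induction q using ind; exact mk_mono le_sup_right
  sup_le p q r := by
    induction p using ind; induction q using ind; induction r using ind
    intro h1 h2
    rw [mk_le_mk] at h1 h2
    refine (mk_le_mk (μ := μ)).2 ?_
    rw [sup_sdiff]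
    exact μ.null_sup h1 h2
  inf_le_left p q := by
    induction p using ind; induction q using ind; exact mk_mono inf_le_left
  inf_le_right p q := by
    induction p using ind; induction q using ind; exact mk_mono inf_le_right
  le_inf p q r := by
    induction p using ind; induction q using ind; induction r using ind
    intro h1 h2
    rw [mk_le_mk] at h1 h2
    refine (mk_le_mk (μ := μ)).2 ?_
    rw [sdiff_inf]
    exact μ.null_sup h1 h2
  le_sup_inf p q r := by
    induction p using ind; induction q using ind; induction r using ind
    exact mk_mono le_sup_inf
  inf_compl_le_bot p := by induction p using ind; exact mk_mono inf_compl_eq_bot.le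
  top_le_sup_compl p := by induction p using ind; exact mk_mono sup_compl_eq_top.ge
  le_top p := by induction p using ind; exact mk_mono le_top
  bot_le p := by induction p using ind; exact mk_mono bot_le

theorem isLUB_mk {s : ℕ → A} {a : A} (h : IsLUB (range s) a) :
    IsLUB (range fun n => mk μ (s n)) (mk μ a) := by
  constructor
  · rintro _ ⟨n, rfl⟩
    exact mk_mono (h.1 ⟨n, rfl⟩)
  · intro q hq
    induction q using ind with | h b =>
    rw [mk_le_mk]
    have h1 : ∀ n, μ (s n \ b) = 0 := fun n => mk_le_mk.1 (hq ⟨n, rfl⟩)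
    refine μ.null_isLUB (s := fun n => s n \ b) ?_ h1
    constructor
    · rintro _ ⟨n, rfl⟩
      exact sdiff_le_sdiff_right (h.1 ⟨n, rfl⟩)
    · intro c hc
      rw [sdiff_le_iff]
      refine h.2 ?_
      rintro _ ⟨n, rfl⟩
      exact sdiff_le_iff.1 (hc ⟨n, rfl⟩)

/-- The quotient morphism. -/
def mkHom (μ : ProbMeas A) : SigmaHom A (NullQuot μ) where
  toFun := mk μ
  map_sup' _ _ := rfl
  map_inf' _ _ := rfl
  map_top' := rfl
  map_bot' := rfl
  map_isLUB' _ _ h := isLUB_mk h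

variable [SigmaComplete A]

instance : SigmaComplete (NullQuot μ) where
  exists_isLUB s := by
    obtain ⟨t, rfl⟩ : ∃ t : ℕ → A, s = fun n => mk μ (t n) :=
      ⟨fun n => (s n).out, funext fun n => (Quotient.out_eq (s n)).symm⟩
    obtain ⟨a, ha⟩ := SigmaComplete.exists_isLUB t
    exact ⟨mk μ a, isLUB_mk ha⟩

end NullQuot

theorem congr_null {a b : A} (h : μ (symmDiff a b) = 0) : μ a = μ b := by
  have key : ∀ a b : A, μ (symmDiff a b) = 0 → μ a ≤ μ b := by
    intro a b h
    calc μ a ≤ μ (b ⊔ a \ b) := μ.mono (by rw [_root_.sup_sdiff_self_right]; exact le_sup_right)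
      _ = μ b + μ (a \ b) := μ.map_sup_disjoint inf_sdiff_self_right
      _ = μ b := by rw [μ.null_of_le le_sup_left h, add_zero]
  exact le_antisymm (key a b h) (key b a (by rwa [symmDiff_comm]))

/-- The measure induced on the quotient. -/
def quotMeas [SigmaComplete A] : ProbMeas (NullQuot μ) where
  toFun := Quotient.lift μ.toFun fun _ _ h => μ.congr_null h
  map_bot' := μ.map_bot'
  map_top' := μ.map_top'
  map_isLUB' s q hd hq := by
    obtain ⟨t, rfl⟩ : ∃ t : ℕ → A, s = fun n => NullQuot.mk μ (t n) :=
      ⟨fun n => (s n).out, funext fun n => (Quotient.out_eq (s n)).symm⟩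
    obtain ⟨a, ha⟩ := SigmaComplete.exists_isLUB t
    rw [hq.unique (NullQuot.isLUB_mk ha)]
    change μ a = ∑' n, μ (t n)
    have h1 : ∀ m n, m ≠ n → μ (t m ⊓ t n) = 0 := by
      intro m n hmn
      have := hd hmn
      have h2 : μ (symmDiff (t m ⊓ t n) ⊥) = 0 := NullQuot.mk_eq_mk.1 this
      rwa [symmDiff_bot] at h2
    rw [μ.map_isLUB' (disjointed t) a (fun m n hmn => (disjoint_disjointed t hmn).eq_bot)
      (isLUB_disjointed ha)]
    congr 1
    funext n
    refine μ.congr_null ?_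
    have h2 : μ (t n ⊓ (Finset.Iio n).sup t) = 0 := by
      rw [Finset.sup_inf_distrib_left]
      refine Finset.sup_induction (p := fun b => μ b = 0) μ.map_bot'
        (fun _ h _ h' => μ.null_sup h h') fun m hm => h1 n m ?_
      exact (Finset.mem_Iio.1 hm).ne'
    refine μ.null_of_le ?_ h2
    rw [disjointed_apply, symmDiff, sdiff_eq_bot_iff.2 sdiff_le, bot_sup_eq, _root_.sdiff_sdiff_right_self]

theorem quotMeas_mk [SigmaComplete A] (a : A) : μ.quotMeas (NullQuot.mk μ a) = μ a := rfl

end ProbMeas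

/-! ### The categories -/

/-- The category of `σ`-complete Boolean algebras. -/
structure SigmaAlg : Type (u + 1) where
  carrier : Type u
  [boolAlg : BooleanAlgebra carrier]
  [sigmaComplete : SigmaComplete carrier]

namespace SigmaAlg

instance : CoeSort SigmaAlg.{u} (Type u) := ⟨SigmaAlg.carrier⟩
instance (A : SigmaAlg.{u}) : BooleanAlgebra A := A.boolAlg
instance (A : SigmaAlg.{u}) : SigmaComplete A := A.sigmaComplete

instance : Category.{u} SigmaAlg.{u} where
  Hom A B := SigmaHom A B
  id A := SigmaHom.id A
  comp f g := SigmaHom.comp g f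

end SigmaAlg

/-- The category of abstract measurable spaces: the opposite of the category of `σ`-complete
Boolean algebras. -/
abbrev AbsMes : Type (u + 1) := SigmaAlg.{u}ᵒᵖ

/-- An abstract probability space: an abstract measurable space with a probability measure. -/
structure AbsProb : Type (u + 1) where
  space : AbsMes.{u}
  prob : ProbMeas space.unop

namespace AbsProb

/-- The algebra of events of an abstract probability space. -/
abbrev Events (X : AbsProb.{u}) : Type u := X.space.unop

/-- A morphism of abstract probability spaces: a morphism of abstract measurable spaces that
pushes the one measure forward to the other. -/
@[ext] structure Hom (X Y : AbsProb.{u}) : Type u where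
  toAbsMes : X.space ⟶ Y.space
  prob_preserved : ∀ E : Y.Events, X.prob (toAbsMes.unop.toFun E) = Y.prob E

/-- The pullback map on events. -/
def Hom.pullback {X Y : AbsProb.{u}} (f : Hom X Y) : SigmaHom Y.Events X.Events :=
  f.toAbsMes.unop

instance : Category.{u} AbsProb.{u} where
  Hom := Hom
  id X := ⟨𝟙 X.space, fun _ => rfl⟩
  comp f g := ⟨f.toAbsMes ≫ g.toAbsMes, fun E =>
    (f.prob_preserved _).trans (g.prob_preserved E)⟩

/-- The forgetful functor to abstract measurable spaces. -/
def forgetToAbsMes : AbsProb.{u} ⥤ AbsMes.{u} where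
  obj X := X.space
  map f := f.toAbsMes

/-- The property of having no nontrivial null events. -/
def IsProbAlg : ObjectProperty AbsProb.{u} := fun X => ∀ E : X.Events, E ≠ ⊥ → 0 < X.prob E

end AbsProb

/-- The category of probability algebras: the abstract probability spaces in which every nonzero
event has positive probability. -/
abbrev ProbAlg : Type (u + 1) := AbsProb.IsProbAlg.{u}.FullSubcategory

/-- The inclusion functor from probability algebras to abstract probability spaces. -/
abbrev Inc : ProbAlg.{u} ⥤ AbsProb.{u} := AbsProb.IsProbAlg.ι

/-- The algebra of events of a probability algebra. -/
abbrev ProbAlg.Events (X : ProbAlg.{u}) : Type u := X.obj.Events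

/-- The probability algebra of an abstract probability space: the quotient of the algebra of
events by the null ideal. -/
def Alg (X : AbsProb.{u}) : ProbAlg.{u} where
  obj := { space := Opposite.op ⟨X.prob.NullQuot⟩, prob := X.prob.quotMeas }
  property := by
    intro q hq
    change X.prob.NullQuot at q
    induction q using ProbMeas.NullQuot.ind with | h a =>
    refine pos_iff_ne_zero.2 fun h => hq ?_
    refine ProbMeas.NullQuot.mk_eq_mk.2 ?_
    rw [symmDiff_bot]
    exact h

/-- The natural monomorphism to an abstract probability space from (the inclusion of) its
probability algebra; on events it is the quotient map. -/
def algInclusion (X : AbsProb.{u}) : Inc.obj (Alg X) ⟶ X where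
  toAbsMes := Quiver.Hom.op (V := SigmaAlg.{u}) (ProbMeas.NullQuot.mkHom X.prob)
  prob_preserved _ := rfl

/-- A compact Hausdorff probability space: a compact Hausdorff space with a probability measure on
its Baire `σ`-algebra. (Such a measure is automatically Radon, i.e. inner regular with respect to
compact `G_δ` sets.) -/
structure CHProb : Type (u + 1) where
  carrier : Type u
  [top : TopologicalSpace carrier]
  [compact : CompactSpace carrier]
  [hausdorff : T2Space carrier]
  meas : @Measure carrier (baire carrier)
  prob : @IsProbabilityMeasure carrier (baire carrier) meas

namespace CHProb

instance : CoeSort CHProb.{u} (Type u) := ⟨CHProb.carrier⟩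
instance (S : CHProb.{u}) : TopologicalSpace S := S.top
instance (S : CHProb.{u}) : CompactSpace S := S.compact
instance (S : CHProb.{u}) : T2Space S := S.hausdorff

/-- The Baire subsets of a compact Hausdorff probability space. -/
abbrev BaireSet (S : CHProb.{u}) : Type u := MeasSet S (baire S)

/-- A morphism of compact Hausdorff probability spaces: a continuous measure-preserving map. -/
@[ext] structure Hom (S T : CHProb.{u}) : Type u where
  toMap : C(S, T)
  meas_preimage : ∀ B : T.BaireSet, S.meas (toMap ⁻¹' B.1) = T.meas B.1

instance : Category.{u} CHProb.{u} where
  Hom := Hom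
  id S := ⟨ContinuousMap.id S, fun _ => rfl⟩
  comp {S T U} f g := ⟨g.toMap.comp f.toMap, fun B =>
    (f.meas_preimage ⟨g.toMap ⁻¹' B.1, measurable_baire g.toMap B.2⟩).trans (g.meas_preimage B)⟩

/-- The abstraction functor: a compact Hausdorff probability space is sent to its Baire
`σ`-algebra with the given measure, and a morphism to the preimage map. -/
def toAbsProb : CHProb.{u} ⥤ AbsProb.{u} where
  obj S :=
    { space := Opposite.op ⟨S.BaireSet⟩
      prob :=
        { toFun := fun B => S.meas B.1
          map_bot' := measure_empty
          map_top' := S.prob.measure_univ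
          map_isLUB' := fun s a hd ha => by
            rw [(MeasSet.isLUB_iff s a).1 ha]
            exact measure_iUnion (fun m n hmn => Set.disjoint_iff_inter_eq_empty.2
              (congrArg Subtype.val (hd hmn))) fun n => (s n).2 } }
  map {S T} f :=
    { toAbsMes := Quiver.Hom.op (V := SigmaAlg.{u})
        (X := ⟨T.BaireSet⟩) (Y := ⟨S.BaireSet⟩)
        (SigmaHom.preimage f.toMap (measurable_baire f.toMap))
      prob_preserved := fun B => f.meas_preimage B }

/-- The probability algebra of a compact Hausdorff probability space. -/
abbrev toProbAlg (S : CHProb.{u}) : ProbAlg.{u} := Alg (toAbsProb.obj S)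

/-- The strong Lusin property: every bounded measurable function agrees almost everywhere with
precisely one continuous function. -/
def StrongLusin (S : CHProb.{u}) : Prop :=
  ∀ f : S → ℂ, Measurable[baire S, borel ℂ] f → (∃ M : ℝ, ∀ x, ‖f x‖ ≤ M) →
    ∃! g : C(S, ℂ), ∀ᵐ x ∂S.meas, g x = f x

end CHProb

/-! ### Concrete models -/

/-- A concrete model of a probability algebra `X`: a compact Hausdorff probability space together
with a morphism of abstract probability spaces from `Inc X` to it, which is a monomorphism in the
category of abstract measurable spaces. -/
structure Model (X : ProbAlg.{u}) : Type (u + 1) where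
  space : CHProb.{u}
  incl : Inc.obj X ⟶ CHProb.toAbsProb.obj space
  mono : Mono (AbsProb.forgetToAbsMes.map incl)

namespace Model

/-- A morphism of concrete models: a morphism of compact Hausdorff probability spaces compatible
with the inclusions. -/
@[ext] structure Hom {X : ProbAlg.{u}} (M N : Model X) : Type u where
  toCHProb : M.space ⟶ N.space
  comm : M.incl ≫ CHProb.toAbsProb.map toCHProb = N.incl

instance (X : ProbAlg.{u}) : Category.{u} (Model X) where
  Hom := Hom
  id M := ⟨𝟙 M.space, by rw [CategoryTheory.Functor.map_id, Category.comp_id]⟩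
  comp f g := ⟨f.toCHProb ≫ g.toCHProb, by
    rw [CategoryTheory.Functor.map_comp, ← Category.assoc, f.comm, g.comm]⟩

end Model

/-- The morphism of abstract probability spaces obtained by applying `Inc` to an isomorphism of
`X` with the probability algebra of `S`, and composing it with the natural monomorphism. -/
def inclOfIso {X : ProbAlg.{u}} {S : CHProb.{u}} (e : X ≅ S.toProbAlg) :
    Inc.obj X ⟶ CHProb.toAbsProb.obj S :=
  Inc.map e.hom ≫ algInclusion (CHProb.toAbsProb.obj S)

/-! ### The canonical model -/

/-- The canonical model of a probability algebra: the Gelfand spectrum of the algebra of bounded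
abstractly measurable functions, with the measure that represents the trace. -/
def Stone (X : ProbAlg.{u}) : CHProb.{u} where
  carrier := Spec X.Events
  meas := rieszBaire X.obj.prob
  prob := rieszBaire_prob X.obj.prob

/-- The characters at which the indicator function `1_E` has the value `1`. -/
def stoneSet {X : ProbAlg.{u}} (E : X.Events) : (Stone X).BaireSet :=
  ⟨{χ : Spec X.Events | χ (LInf.ind E) = 1}, by
    let ev : C(Spec X.Events, ℂ) := WeakDual.gelfandTransform ℂ (LInf X.Events) (LInf.ind E)
    have h1 : MeasurableSet[borel ℂ] ({1} : Set ℂ) := by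
      borelize ℂ
      exact measurableSet_singleton 1
    exact (le_iSup (fun f : C(Spec X.Events, ℂ) => (borel ℂ).comap f) ev) _ ⟨{1}, h1, rfl⟩⟩

/-- The natural isomorphism of `X` with the probability algebra of its canonical model is the one
that matches an event `E` with the class of the set of characters `χ` with `χ (1_E) = 1`, i.e. the
set whose indicator function is the Gelfand transform of `1_E`. -/
def IsNaturalIso {X : ProbAlg.{u}} (e : X ≅ (Stone X).toProbAlg) : Prop :=
  ∀ E : X.Events, (Inc.map e.inv).pullback E =
    ProbMeas.NullQuot.mk (CHProb.toAbsProb.obj (Stone X)).prob (stoneSet E)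

/-- The Koopman operator `f ↦ f ∘ π` on bounded abstractly measurable functions. -/
def koopman {X Y : ProbAlg.{u}} (π : X ⟶ Y) (f : LInf Y.Events) : LInf X.Events :=
  ⟨(Inc.map π).pullback.comp f.1, by
    obtain ⟨M, hM⟩ := f.2
    exact ⟨M, by rw [SigmaHom.comp_apply, hM, map_top]⟩⟩

/-- `T` is the map of canonical models induced by `π`: it sends a character `χ` to the character
`f ↦ χ (f ∘ π)`. -/
def IsStoneMap {X Y : ProbAlg.{u}} (π : X ⟶ Y) (T : Stone X ⟶ Stone Y) : Prop :=
  ∀ (χ : Spec X.Events) (f : LInf Y.Events), (show Spec Y.Events from T.toMap χ) f = χ (koopman π f)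

end CanonModel

end

open CanonModel

noncomputable section

namespace CanonModel

open StoneSp LInf TopologicalSpace WeakDual.CharacterSpace

/-! ### Epimorphisms onto probability algebras -/

/-! The bridge between abstract events and points is the Stone space `StoneSp X.Events`, whose
points are the ultrafilters of events.

For (i), the content is that a monomorphism of abstract measurable spaces out of a probability
algebra is surjective on events (`surjective_of_epi`, `mono_iff_surjective`). Let `φ : A → B` be an
epimorphism onto a probability algebra. Minimising measure gives each event of `B` a least majorant
in the range of `φ` (`exists_upper_envelope`). In the space of pairs of ultrafilters of `B` with the
same restriction along `φ`, these envelopes make both projections open (`FibreProd.isOpenMap_fst`),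
so pulling back along them gives two countably join-preserving maps from `B` to a regular open
algebra (`openMapHom`). The two agree after `φ`, hence are equal; but an event strictly below its
envelope would tell them apart. Once surjectivity is known, the kernel is exactly the null ideal,
because `X` has no null events except `⊥` (`exists_iso_of_surjective`).

For (ii), bounded functions on `X` are the continuous functions on the Stone space, so the Gelfand
spectrum is that Stone space (`stoneSpec`), with the Riesz measure giving the clopen set of `E` the
mass of `E` (`rieszBorel_specSet`). Baire sets are generated by these clopen sets, and countable
joins differ from unions by null sets, so events correspond to Baire sets modulo null sets
(`stoneHom_bijective`). The Gelfand transform supplies the continuous representatives needed for the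
strong Lusin property (`stone_strongLusin`).

For (iii), strong Lusin lets identities between events be read pointwise, so that each point of the
model determines an ultrafilter of events (`toStoneSp`); in any other model an ultrafilter of Baire
sets converges by compactness (`limitMap`). The composite is a morphism, and it is unique because
continuous functions equal almost everywhere coincide (`Model.hom_unique`). Conversely an initial
model is isomorphic to the canonical one, and strong Lusin is invariant under isomorphism. -/

instance regularOpens_sigmaComplete (P : Type u) [TopologicalSpace P] :
    SigmaComplete (Heyting.Regular (Opens P)) where
  exists_isLUB s := by
    refine ⟨Heyting.Regular.toRegular (⨆ n, (s n : Opens P)), ?_, fun b hb => ?_⟩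
    · rintro _ ⟨n, rfl⟩
      rw [← Heyting.Regular.coe_le_coe]
      exact (le_iSup (fun n => (s n : Opens P)) n).trans
        (Heyting.Regular.gi.gc.le_u_l _)
    · refine Heyting.Regular.gi.gc.l_le (iSup_le fun n => ?_)
      exact Heyting.Regular.coe_le_coe.2 (hb ⟨n, rfl⟩)

/-! ### Open maps to a Stone space and regular open algebras -/

section OpenMap

variable {A : Type u} [BooleanAlgebra A] {P : Type v} [TopologicalSpace P]

/-- The preimage of a basic clopen set. -/
def basicOpen (p : C(P, StoneSp A)) (a : A) : Opens P :=
  ⟨p ⁻¹' basic a, (isClopen_basic a).2.preimage p.continuous⟩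

/-- The complement in `Opens P` is only a pseudocomplement, the interior of the set complement; for
a clopen set the two agree. Hence such preimages are regular. -/
theorem basicOpen_compl (p : C(P, StoneSp A)) (a : A) : (basicOpen p a)ᶜ = basicOpen p aᶜ := by
  refine IsCompl.compl_eq (IsCompl.of_eq ?_ ?_)
  · ext q
    change q ∈ p ⁻¹' basic a ∩ p ⁻¹' basic aᶜ ↔ q ∈ (∅ : Set P)
    simp [basic_compl]
  · ext q
    change q ∈ p ⁻¹' basic a ∪ p ⁻¹' basic aᶜ ↔ q ∈ (univ : Set P)
    simp [basic_compl]

/-- The preimage of a basic clopen set, as a regular open set. -/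
def basicRegular (p : C(P, StoneSp A)) (a : A) : Heyting.Regular (Opens P) :=
  ⟨basicOpen p a, by rw [Heyting.IsRegular, basicOpen_compl, basicOpen_compl, _root_.compl_compl]⟩

/-- Pulling back along an open continuous map to the Stone space preserves countable joins. -/
def openMapHom (p : C(P, StoneSp A)) (hp : IsOpenMap p) :
    SigmaHom A (Heyting.Regular (Opens P)) where
  toFun := basicRegular p
  map_sup' a b := by
    apply Heyting.Regular.coe_injective
    rw [Heyting.Regular.coe_sup]
    change basicOpen p (a ⊔ b) = (basicOpen p a ⊔ basicOpen p b)ᶜᶜ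
    have : basicOpen p a ⊔ basicOpen p b = basicOpen p (a ⊔ b) := by
      ext q
      change q ∈ p ⁻¹' basic a ∪ p ⁻¹' basic b ↔ q ∈ p ⁻¹' basic (a ⊔ b)
      rw [basic_sup]; rfl
    rw [this, basicOpen_compl, basicOpen_compl, _root_.compl_compl]
  map_inf' a b := by
    apply Heyting.Regular.coe_injective
    ext q
    change q ∈ p ⁻¹' basic (a ⊓ b) ↔ q ∈ p ⁻¹' basic a ∩ p ⁻¹' basic b
    rw [basic_inf]; rfl
  map_top' := by
    apply Heyting.Regular.coe_injective
    ext q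
    change q ∈ p ⁻¹' basic ⊤ ↔ q ∈ (univ : Set P)
    rw [basic_top]; rfl
  map_bot' := by
    apply Heyting.Regular.coe_injective
    ext q
    change q ∈ p ⁻¹' basic ⊥ ↔ q ∈ (∅ : Set P)
    rw [basic_bot]; rfl
  map_isLUB' s a h := by
    constructor
    · rintro _ ⟨n, rfl⟩
      exact fun q hq => basic_mono (h.1 ⟨n, rfl⟩) hq
    · intro V hV
      -- As `V` is regular, a failure of the inequality yields a nonempty open `W` inside the
      -- preimage of `a` and disjoint from `V`. Openness of `p` puts a basic set of some `b` inside
      -- `p '' W`. This `b` is disjoint from every `s n`, hence from `a`, which contradicts `W`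
      -- lying over `a`.
      rw [← Heyting.Regular.coe_le_coe, ← V.prop.eq, le_compl_iff_disjoint_right, disjoint_iff]
      by_contra hne
      obtain ⟨q, hq⟩ := (Opens.ne_bot_iff_nonempty _).1 hne
      set W : Opens P := basicOpen p a ⊓ ((V : Opens P))ᶜ
      obtain ⟨b, hb, hbW⟩ := exists_basic_between (isCompact_singleton (x := p q))
        (hp _ W.isOpen) (singleton_subset_iff.2 (mem_image_of_mem p hq))
      have hle : a ≤ bᶜ := by
        apply h.2
        rintro _ ⟨n, rfl⟩
        rw [le_compl_iff_disjoint_right, disjoint_iff]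
        by_contra hnd
        obtain ⟨y, hy⟩ := basic_nonempty hnd
        rw [basic_inf] at hy
        obtain ⟨q', hq', rfl⟩ := hbW hy.2
        have h1 : q' ∈ (V : Opens P) := Heyting.Regular.coe_le_coe.2 (hV ⟨n, rfl⟩) hy.1
        have h2 : q' ∈ (V : Opens P) ⊓ ((V : Opens P))ᶜ := ⟨h1, hq'.2⟩
        rw [inf_compl_self] at h2
        exact h2
      have h1 := basic_mono hle hq.1
      rw [basic_compl] at h1
      exact h1 (hb rfl)

end OpenMap

/-! ### Upper envelopes and the fibre product -/

section Envelope

variable {A : Type u} {B : Type v} [BooleanAlgebra A] [BooleanAlgebra B]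

theorem ProbMeas.le_one (μ : ProbMeas B) (b : B) : μ b ≤ 1 := μ.map_top' ▸ μ.mono le_top

/-- An event of a probability algebra has a least majorant in the range of a morphism. -/
theorem exists_upper_envelope [SigmaComplete A] (μ : ProbMeas B) (hμ : ∀ b : B, b ≠ ⊥ → 0 < μ b)
    (φ : SigmaHom A B) (y : B) :
    ∃ a : A, y ≤ φ a ∧ ∀ a' : A, y ≤ φ a' → φ a ≤ φ a' := by
  -- The envelope is a majorant of least measure: the meet `cᶜ` of a minimising sequence.
  let S : Set ℝ≥0∞ := (fun a => μ (φ a)) '' {a | y ≤ φ a}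
  have hS : S.Nonempty := ⟨_, ⊤, by simp, rfl⟩
  obtain ⟨r, -, hr, hrS⟩ := exists_seq_tendsto_sInf hS (OrderBot.bddBelow S)
  choose t ht htr using hrS
  obtain ⟨c, hc⟩ := SigmaComplete.exists_isLUB fun n => (t n)ᶜ
  have hlub := φ.map_isLUB hc
  have hy : y ≤ φ cᶜ := by
    rw [map_compl', le_compl_comm]
    refine hlub.2 ?_
    rintro _ ⟨n, rfl⟩
    change φ (t n)ᶜ ≤ yᶜ
    rw [map_compl']
    exact compl_le_compl (ht n)
  have hle : ∀ n, φ cᶜ ≤ φ (t n) := fun n =>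
    OrderHomClass.mono φ (compl_le_of_compl_le (hc.1 ⟨n, rfl⟩))
  have hm : μ (φ cᶜ) ≤ sInf S := ge_of_tendsto' hr fun n => (μ.mono (hle n)).trans (htr n).le
  refine ⟨cᶜ, hy, fun a' ha' => ?_⟩
  by_contra hn
  -- If `φ cᶜ` were not below `φ a'`, then `cᶜ ⊓ a'` would still give a majorant, of strictly
  -- smaller measure. Strictness uses positivity of `μ` on nonzero events and finiteness of its
  -- values.
  have hpos : 0 < μ (φ cᶜ \ φ a') := hμ _ (by rwa [Ne, sdiff_eq_bot_iff])
  have h1 : μ (φ cᶜ) ≤ μ (φ cᶜ ⊓ φ a') := hm.trans (sInf_le ⟨cᶜ ⊓ a', by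
    change y ≤ φ (cᶜ ⊓ a')
    rw [map_inf]; exact le_inf hy ha', by simp only [map_inf]⟩)
  have h2 := μ.map_sup_disjoint (inf_inf_sdiff (φ cᶜ) (φ a'))
  rw [sup_inf_sdiff] at h2
  have h3 := ENNReal.lt_add_right
    (ne_top_of_le_ne_top ENNReal.one_ne_top (μ.le_one (φ cᶜ ⊓ φ a'))) hpos.ne'
  rw [← h2] at h3
  exact h3.not_ge h1

/-- The pairs of points of the Stone space of `B` that restrict to the same point on the range
of `φ`. -/
def FibreProd (φ : SigmaHom A B) : Type v :=
  {q : StoneSp B × StoneSp B // ∀ a, q.1.1 (φ a) = q.2.1 (φ a)}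

namespace FibreProd

instance (φ : SigmaHom A B) : TopologicalSpace (FibreProd φ) :=
  inferInstanceAs (TopologicalSpace (Subtype _))

/-- The first projection. -/
def fst (φ : SigmaHom A B) : C(FibreProd φ, StoneSp B) :=
  ⟨fun q => q.1.1, continuous_fst.comp continuous_subtype_val⟩

/-- The exchange of the coordinates. -/
def swap (φ : SigmaHom A B) : FibreProd φ ≃ₜ FibreProd φ where
  toFun q := ⟨(q.1.2, q.1.1), fun a => (q.2 a).symm⟩
  invFun q := ⟨(q.1.2, q.1.1), fun a => (q.2 a).symm⟩
  left_inv _ := rfl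
  right_inv _ := rfl
  continuous_toFun := Continuous.subtype_mk (continuous_swap.comp continuous_subtype_val) _
  continuous_invFun := Continuous.subtype_mk (continuous_swap.comp continuous_subtype_val) _

end FibreProd

/-- Compactness: the sets `basic (φ c ⊓ y)`, over those `c` with `z ∈ basic (φ c)`, form a directed
family. None is empty, since `φ c ⊓ y = ⊥` gives `y ≤ φ cᶜ`, hence `φ a ≤ φ cᶜ` by minimality,
although `z` lies in both `φ a` and `φ c`. Any point of the intersection serves; passing to
complements turns the implications into equalities. -/
theorem exists_mem_basic_agree (φ : SigmaHom A B) {y : B} {a : A}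
    (hya : ∀ a' : A, y ≤ φ a' → φ a ≤ φ a') {z : StoneSp B} (hz : z ∈ basic (φ a)) :
    ∃ z' ∈ basic y, ∀ c : A, z.1 (φ c) = z'.1 (φ c) := by
  have : Nonempty {c : A // z ∈ basic (φ c)} := ⟨⟨a, hz⟩⟩
  obtain ⟨z', hz'⟩ := IsCompact.nonempty_iInter_of_directed_nonempty_isCompact_isClosed
    (fun c : {c : A // z ∈ basic (φ c)} => basic (φ c.1 ⊓ y))
    (by
      rintro ⟨c, hc⟩ ⟨d, hd⟩
      exact ⟨⟨c ⊓ d, by rw [map_inf, basic_inf]; exact ⟨hc, hd⟩⟩,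
        basic_mono (inf_le_inf_right _ (OrderHomClass.mono φ inf_le_left)),
        basic_mono (inf_le_inf_right _ (OrderHomClass.mono φ inf_le_right))⟩)
    (by
      rintro ⟨c, hc⟩
      refine basic_nonempty fun h => ?_
      have h1 : y ≤ φ cᶜ := by
        rw [map_compl', le_compl_iff_disjoint_left, disjoint_iff]; exact h
      have h2 := basic_mono (hya _ h1) hz
      rw [map_compl', basic_compl] at h2
      exact h2 hc)
    (fun c => (isClopen_basic _).1.isCompact) (fun c => (isClopen_basic _).1)
  have key : ∀ c : A, z ∈ basic (φ c) → z' ∈ basic (φ c) ∩ basic y := fun c hc => by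
    rw [← basic_inf]; exact mem_iInter.1 hz' ⟨c, hc⟩
  refine ⟨z', (key a hz).2, fun c => ?_⟩
  by_cases hc : z ∈ basic (φ c)
  · exact hc.trans (key c hc).1.symm
  · have h1 := (key cᶜ (by rw [map_compl', basic_compl]; exact hc)).1
    rw [map_compl', basic_compl] at h1
    exact (Bool.eq_false_iff.2 hc).trans (Bool.eq_false_iff.2 h1).symm

/-- A point over `basic x × basic y` has its first coordinate in `basic (x ⊓ φ a)`, with `φ a` the
envelope of `y`. Conversely each `z` in that clopen set has a partner in `basic y` by
`exists_mem_basic_agree`, so the image is a neighbourhood. -/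
theorem FibreProd.isOpenMap_fst (φ : SigmaHom A B)
    (h : ∀ y : B, ∃ a : A, y ≤ φ a ∧ ∀ a' : A, y ≤ φ a' → φ a ≤ φ a') :
    IsOpenMap (FibreProd.fst φ) := by
  intro U hU
  obtain ⟨V, hV, rfl⟩ := isOpen_induced_iff.1 hU
  rw [isOpen_iff_mem_nhds]
  rintro _ ⟨q, hq, rfl⟩
  obtain ⟨S, T, hS, hT, hqS, hqT, hST⟩ := isOpen_prod_iff.1 hV q.1.1 q.1.2 hq
  obtain ⟨x, hx, hxS⟩ := exists_basic_between (isCompact_singleton (x := q.1.1)) hS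
    (singleton_subset_iff.2 hqS)
  obtain ⟨y, hy, hyT⟩ := exists_basic_between (isCompact_singleton (x := q.1.2)) hT
    (singleton_subset_iff.2 hqT)
  obtain ⟨a, hya, ha⟩ := h y
  have hmem : q.1.1 ∈ basic (x ⊓ φ a) := by
    rw [basic_inf]
    exact ⟨hx rfl, (q.2 a).trans (basic_mono hya (hy rfl))⟩
  filter_upwards [(isClopen_basic (x ⊓ φ a)).2.mem_nhds hmem] with z hz
  rw [basic_inf] at hz
  obtain ⟨z', hz', hzz'⟩ := exists_mem_basic_agree φ ha hz.2
  exact ⟨⟨(z, z'), hzz'⟩, hST ⟨hxS hz.1, hyT hz'⟩, rfl⟩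

end Envelope

/-- An epimorphism of `σ`-complete Boolean algebras with values in a probability algebra is
surjective. -/
theorem surjective_of_epi {A B : SigmaAlg.{u}} (μ : ProbMeas B)
    (hμ : ∀ b : B, b ≠ ⊥ → 0 < μ b) (φ : A ⟶ B) [Epi φ] :
    Function.Surjective (show SigmaHom A B from φ) := by
  set f : SigmaHom A B := φ
  have henv := exists_upper_envelope μ hμ f
  have ho := FibreProd.isOpenMap_fst f henv
  let p₂ : C(FibreProd f, StoneSp B) := (FibreProd.fst f).comp (FibreProd.swap f)
  have ho₂ : IsOpenMap p₂ := ho.comp (FibreProd.swap f).isOpenMap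
  let D : SigmaAlg.{u} := ⟨Heyting.Regular (Opens (FibreProd f))⟩
  let g₁ : B ⟶ D := openMapHom (FibreProd.fst f) ho
  let g₂ : B ⟶ D := openMapHom p₂ ho₂
  -- The two coordinates of a point of the fibre product agree on the range of `φ` by definition.
  have heq : φ ≫ g₁ = φ ≫ g₂ := by
    refine SigmaHom.ext fun a => Heyting.Regular.coe_injective (Opens.ext (Set.ext fun q => ?_))
    change q.1.1.1 (f a) = true ↔ q.1.2.1 (f a) = true
    rw [q.2 a]
  have h12 : g₁ = g₂ := (cancel_epi φ).1 heq
  intro b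
  obtain ⟨a, hba, ha⟩ := henv b
  refine ⟨a, le_antisymm ?_ hba⟩
  by_contra hn
  -- Take `z` in the envelope of `b` but outside `b`, and a partner `z'` inside `b`. The pair is in
  -- the preimage of `b` under the second projection and not under the first, against `g₁ = g₂`.
  obtain ⟨z, hz⟩ := basic_nonempty (a := f a ⊓ bᶜ) (by rwa [Ne, ← _root_.sdiff_eq, sdiff_eq_bot_iff])
  rw [basic_inf, basic_compl] at hz
  obtain ⟨z', hz', hzz'⟩ := exists_mem_basic_agree f ha hz.1
  let q : FibreProd f := ⟨(z, z'), hzz'⟩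
  have h1 : q ∈ (openMapHom p₂ ho₂ b : Opens (FibreProd f)) := hz'
  have h2 : q ∈ (openMapHom (FibreProd.fst f) ho b : Opens (FibreProd f)) := by
    have : openMapHom (FibreProd.fst f) ho = openMapHom p₂ ho₂ := h12
    rw [this]; exact h1
  exact hz.2 h2

theorem epi_of_surjective {A B : SigmaAlg.{u}} (φ : A ⟶ B)
    (h : Function.Surjective (show SigmaHom A B from φ)) : Epi φ where
  left_cancellation g₁ g₂ hg := by
    refine SigmaHom.ext fun b => ?_
    obtain ⟨a, rfl⟩ := h b
    exact DFunLike.congr_fun (F := SigmaHom A _) hg a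

/-! ### Isomorphisms of probability algebras -/

section Inverse

variable {A : Type u} {B : Type v} [BooleanAlgebra A] [BooleanAlgebra B]

theorem SigmaHom.le_iff_of_injective (f : SigmaHom A B) (hf : Function.Injective f) {a b : A} :
    f a ≤ f b ↔ a ≤ b := by
  rw [← inf_eq_left, ← map_inf, hf.eq_iff, inf_eq_left]

/-- A bijective morphism, as an order isomorphism. -/
def SigmaHom.toOrderIso (f : SigmaHom A B) (hf : Function.Bijective f) : A ≃o B where
  toEquiv := Equiv.ofBijective f hf
  map_rel_iff' := f.le_iff_of_injective hf.1

/-- The inverse of a bijective morphism. -/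
def SigmaHom.inverse (f : SigmaHom A B) (hf : Function.Bijective f) : SigmaHom B A where
  toFun := (f.toOrderIso hf).symm
  map_sup' := map_sup (f.toOrderIso hf).symm
  map_inf' := map_inf (f.toOrderIso hf).symm
  map_top' := map_top (f.toOrderIso hf).symm
  map_bot' := map_bot (f.toOrderIso hf).symm
  map_isLUB' s a h := by
    have := (f.toOrderIso hf).symm.isLUB_image'.2 h
    rwa [← range_comp] at this

theorem SigmaHom.inverse_apply (f : SigmaHom A B) (hf : Function.Bijective f) (a : A) :
    f.inverse hf (f a) = a := (f.toOrderIso hf).symm_apply_apply a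

theorem SigmaHom.apply_inverse (f : SigmaHom A B) (hf : Function.Bijective f) (b : B) :
    f (f.inverse hf b) = b := (f.toOrderIso hf).apply_symm_apply b

end Inverse

/-- A bijective measure-preserving morphism between algebras of events is an isomorphism. -/
def ProbAlg.isoOfBijective {X Y : ProbAlg.{u}} (f : SigmaHom Y.Events X.Events)
    (hf : Function.Bijective f) (hp : ∀ E, X.obj.prob (f E) = Y.obj.prob E) : X ≅ Y where
  hom := ⟨{ toAbsMes := Quiver.Hom.op (V := SigmaAlg.{u}) f, prob_preserved := hp }⟩
  inv := ⟨{ toAbsMes := Quiver.Hom.op (V := SigmaAlg.{u}) (f.inverse hf)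
            prob_preserved := fun E => by
              rw [← hp]
              exact congrArg X.obj.prob.toFun (f.apply_inverse hf E) }⟩
  hom_inv_id := by
    refine ObjectProperty.hom_ext _ (AbsProb.Hom.ext (Quiver.Hom.unop_inj ?_))
    exact SigmaHom.ext (f.apply_inverse hf)
  inv_hom_id := by
    refine ObjectProperty.hom_ext _ (AbsProb.Hom.ext (Quiver.Hom.unop_inj ?_))
    exact SigmaHom.ext (f.inverse_apply hf)

theorem AbsProb.hom_ext {X Y : AbsProb.{u}} {f g : X ⟶ Y} (h : ∀ E, f.pullback E = g.pullback E) :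
    f = g :=
  AbsProb.Hom.ext (Quiver.Hom.unop_inj (SigmaHom.ext h))

theorem AbsProb.comp_pullback {X Y Z : AbsProb.{u}} (f : X ⟶ Y) (g : Y ⟶ Z) (E : Z.Events) :
    Hom.pullback (f ≫ g) E = f.pullback (g.pullback E) := rfl

theorem iso_pullback_hom_inv {X Y : ProbAlg.{u}} (e : X ≅ Y) (E : X.Events) :
    (Inc.map e.hom).pullback ((Inc.map e.inv).pullback E) = E := by
  rw [← AbsProb.comp_pullback, ← Functor.map_comp, e.hom_inv_id]
  rfl

/-! ### Morphisms out of a probability algebra -/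

section Incl

variable {X : ProbAlg.{u}} {Y : AbsProb.{u}} (f : Inc.obj X ⟶ Y)

theorem prob_pullback (E : Y.Events) : X.obj.prob (f.pullback E) = Y.prob E := f.prob_preserved E

theorem ProbAlg.eq_bot_of_prob {E : X.Events} (h : X.obj.prob E = 0) : E = ⊥ := by
  by_contra hn
  exact (X.property E hn).ne' h

/-- The pullback preserves measure and the only null event of `X` is `⊥`, so its kernel is exactly
the null ideal of `Y`. This makes the map induced on the quotient well defined and injective. -/
theorem pullback_eq_iff {E F : Y.Events} :
    f.pullback E = f.pullback F ↔ Y.prob (symmDiff E F) = 0 := by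
  rw [← prob_pullback f, map_symmDiff']
  constructor
  · intro h
    rw [h, symmDiff_self]
    exact X.obj.prob.map_bot'
  · intro h
    exact symmDiff_eq_bot.1 (ProbAlg.eq_bot_of_prob h)

/-- A surjective morphism identifies `X` with the probability algebra of its codomain. -/
theorem exists_iso_of_surjective (hf : Function.Surjective f.pullback) :
    ∃ e : X ≅ Alg Y, f = Inc.map e.hom ≫ algInclusion Y := by
  let g : SigmaHom Y.Events X.Events := f.pullback
  let q : Y.prob.NullQuot → X.Events :=
    Quotient.lift g fun _ _ h => (pullback_eq_iff f).2 h
  let φ : SigmaHom Y.prob.NullQuot X.Events :=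
    { toFun := q
      map_sup' := fun a b => by
        induction a using ProbMeas.NullQuot.ind; induction b using ProbMeas.NullQuot.ind
        exact map_sup g _ _
      map_inf' := fun a b => by
        induction a using ProbMeas.NullQuot.ind; induction b using ProbMeas.NullQuot.ind
        exact map_inf g _ _
      map_top' := map_top g
      map_bot' := map_bot g
      map_isLUB' := fun s a h => by
        obtain ⟨t, rfl⟩ : ∃ t : ℕ → Y.Events, s = fun n => ProbMeas.NullQuot.mk _ (t n) :=
          ⟨fun n => (s n).out, funext fun n => (Quotient.out_eq (s n)).symm⟩
        obtain ⟨b, hb⟩ := SigmaComplete.exists_isLUB t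
        rw [h.unique (ProbMeas.NullQuot.isLUB_mk hb)]
        exact f.pullback.map_isLUB hb }
  have hbij : Function.Bijective φ := by
    refine ⟨fun a b h => ?_, fun E => ?_⟩
    · induction a using ProbMeas.NullQuot.ind; induction b using ProbMeas.NullQuot.ind
      exact ProbMeas.NullQuot.mk_eq_mk.2 ((pullback_eq_iff f).1 h)
    · obtain ⟨F, rfl⟩ := hf E
      exact ⟨ProbMeas.NullQuot.mk _ F, rfl⟩
  refine ⟨ProbAlg.isoOfBijective (Y := Alg Y) φ hbij fun a => ?_, rfl⟩
  change Y.prob.NullQuot at a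
  induction a using ProbMeas.NullQuot.ind
  exact prob_pullback f _

/-- A morphism from a probability algebra is a monomorphism of abstract measurable spaces if and
only if it is surjective on events. -/
theorem mono_iff_surjective :
    Mono (AbsProb.forgetToAbsMes.map f) ↔ Function.Surjective f.pullback := by
  constructor
  · intro h
    -- Abstract measurable spaces form the opposite category, so a monomorphism there is an
    -- epimorphism of algebras.
    have : Epi (AbsProb.forgetToAbsMes.map f).unop := (unop_epi_iff _).2 h
    exact @surjective_of_epi _ _ X.obj.prob X.property _ this
  · intro h
    have : Epi (AbsProb.forgetToAbsMes.map f).unop := epi_of_surjective _ h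
    exact unop_epi_iff _ |>.1 this

theorem surjective_algInclusion_iso {Y : AbsProb.{u}} (e : X ≅ Alg Y) :
    Function.Surjective (AbsProb.Hom.pullback (Inc.map e.hom ≫ algInclusion Y)) := by
  intro E
  obtain ⟨F, hF⟩ : ∃ F, ProbMeas.NullQuot.mk Y.prob F = (Inc.map e.inv).pullback E :=
    ⟨_, Quotient.out_eq _⟩
  refine ⟨F, ?_⟩
  rw [AbsProb.comp_pullback]
  refine Eq.trans ?_ (iso_pullback_hom_inv e E)
  rw [← hF]
  rfl

end Incl

/-! ### Baire sets and Baire measurable functions -/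

section Baire

variable {A : Type u} [BooleanAlgebra A] {S : Type v} [TopologicalSpace S]

/-- Preimages of Borel sets under a complex continuous function, as Baire sets. -/
def bairePre (g : C(S, ℂ)) : SigmaHom (BorelSet ℂ) (MeasSet S (baire S)) :=
  SigmaHom.preimage g ((comap_measurable g).mono (le_iSup (fun f : C(S, ℂ) => (borel ℂ).comap f) g)
    le_rfl)

theorem measurable_baire_complex (g : C(S, ℂ)) : Measurable[baire S, borel ℂ] g :=
  (comap_measurable g).mono (le_iSup (fun f : C(S, ℂ) => (borel ℂ).comap f) g) le_rfl

/-- The Baire algebra is generated by preimages of open subsets of `ℂ` under continuous functions.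
-/
theorem baire_induction {P : MeasSet S (baire S) → Prop}
    (ho : ∀ (g : C(S, ℂ)) (U : BorelSet ℂ), IsOpen U.1 → P (bairePre g U))
    (hc : ∀ B, P B → P Bᶜ)
    (hu : ∀ (s : ℕ → MeasSet S (baire S)) (a : MeasSet S (baire S)), IsLUB (range s) a →
      (∀ n, P (s n)) → P a)
    (B : MeasSet S (baire S)) : P B := by
  have hgen : baire S = MeasurableSpace.generateFrom
      (⋃ g : C(S, ℂ), preimage g '' {U : Set ℂ | IsOpen U}) := by
    rw [← MeasurableSpace.iSup_generateFrom]
    exact iSup_congr fun g => MeasurableSpace.comap_generateFrom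
  suffices H : ∀ B : Set S, MeasurableSet[MeasurableSpace.generateFrom
      (⋃ g : C(S, ℂ), preimage g '' {U : Set ℂ | IsOpen U})] B →
      ∀ hB : MeasurableSet[baire S] B, P ⟨B, hB⟩ from H B.1 (hgen ▸ B.2) B.2
  intro B hB
  induction B, hB using MeasurableSpace.generateFrom_induction with
  | hC t ht ht' =>
    intro hB
    obtain ⟨g, U, hU, rfl⟩ := mem_iUnion.1 ht
    exact ho g ⟨U, MeasurableSpace.measurableSet_generateFrom hU⟩ hU
  | empty =>
    intro hB
    exact ho 0 ⊥ isOpen_empty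
  | compl t ht ih =>
    intro hB
    exact hc ⟨t, hgen ▸ ht⟩ (ih _)
  | iUnion s hs ih =>
    intro hB
    exact hu (fun n => ⟨s n, hgen ▸ hs n⟩) _ ((MeasSet.isLUB_iff _ _).2 rfl) fun n => ih n _

theorem SigmaHom.ext_baire {α β : SigmaHom (MeasSet S (baire S)) A}
    (h : ∀ (g : C(S, ℂ)) (U : BorelSet ℂ), IsOpen U.1 → α (bairePre g U) = β (bairePre g U)) :
    α = β := by
  ext B
  induction B using baire_induction with
  | ho g U hU => exact h g U hU
  | hc B ih => rw [map_compl', map_compl', ih]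
  | hu s a ha ih =>
    have h1 := α.map_isLUB ha
    simp only [ih] at h1
    exact h1.unique (β.map_isLUB ha)

/-- An inequality of morphisms on open sets is an equality. -/
theorem SigmaHom.eq_of_le_open {E : Type w} [PseudoEMetricSpace E]
    {α β : SigmaHom (BorelSet E) A} (h : ∀ U : BorelSet E, IsOpen U.1 → α U ≤ β U) : α = β := by
  refine SigmaHom.ext_borel fun U hU => le_antisymm (h U hU) ?_
  obtain ⟨F, hF, hFU, hFe, -⟩ := hU.exists_iUnion_isClosed
  let G : ℕ → BorelSet E := fun n => ⟨F n, by borelize E; exact (hF n).measurableSet⟩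
  have hG : IsLUB (range G) U := (MeasSet.isLUB_iff _ _).2 hFe.symm
  refine (β.map_isLUB hG).2 ?_
  rintro _ ⟨n, rfl⟩
  -- On the open complement of a closed set the hypothesis reverses under complementation, giving `β
  -- ≤ α` on closed sets. An open set is a countable union of closed sets, so the reverse inequality
  -- passes to it.
  have h1 := h (G n)ᶜ (hF n).isOpen_compl
  rw [map_compl', map_compl', compl_le_compl_iff_le] at h1
  exact h1.trans (OrderHomClass.mono α (hG.1 ⟨n, rfl⟩))

/-- Maps built by a compactness argument give only an inclusion of preimages of open sets; this is
what upgrades it to equality. For fixed `g`, both sides are morphisms on the Borel algebra of `ℂ`.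
-/
theorem SigmaHom.ext_baire_of_le {α β : SigmaHom (MeasSet S (baire S)) A}
    (h : ∀ (g : C(S, ℂ)) (U : BorelSet ℂ), IsOpen U.1 → α (bairePre g U) ≤ β (bairePre g U)) :
    α = β :=
  SigmaHom.ext_baire fun g U _ => DFunLike.congr_fun
    (SigmaHom.eq_of_le_open (α := α.comp (bairePre g)) (β := β.comp (bairePre g)) (h g)) U

end Baire

instance CHProb.measurableSpace (S : CHProb.{u}) : MeasurableSpace S := baire S

instance (S : CHProb.{u}) : IsProbabilityMeasure S.meas := S.prob

/-! ### Equality of events and equality almost everywhere -/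

section AE

variable {X : ProbAlg.{u}} {S : CHProb.{u}} (f : Inc.obj X ⟶ CHProb.toAbsProb.obj S)

/-- The morphism on Baire sets underlying a morphism of abstract probability spaces. -/
def eventHom : SigmaHom S.BaireSet X.Events := f.pullback

theorem prob_eventHom (B : S.BaireSet) : X.obj.prob (eventHom f B) = S.meas B.1 :=
  prob_pullback f B

theorem eventHom_eq_iff {B C : S.BaireSet} :
    eventHom f B = eventHom f C ↔ (B.1 : Set S) =ᵐ[S.meas] C.1 :=
  (pullback_eq_iff f).trans (measure_symmDiff_eq_zero_iff (μ := S.meas) (s := B.1) (t := C.1))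

/-- Countably many open sets separate the points of `ℂ`, so it is enough that the preimages of each
open set agree up to a null set. -/
theorem ae_eq_of_comp_eq {g h : S → ℂ} (hg : Measurable[baire S, borel ℂ] g)
    (hh : Measurable[baire S, borel ℂ] h)
    (H : (eventHom f).comp (SigmaHom.preimage g hg) = (eventHom f).comp (SigmaHom.preimage h hh)) :
    g =ᵐ[S.meas] h := by
  refine Filter.EventuallyEq.of_forall_separating_preimage IsOpen fun U hU => ?_
  exact (eventHom_eq_iff f (B := SigmaHom.preimage g hg ⟨U, MeasurableSpace.measurableSet_generateFrom hU⟩)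
    (C := SigmaHom.preimage h hh ⟨U, MeasurableSpace.measurableSet_generateFrom hU⟩)).1
    (DFunLike.congr_fun H _)

theorem ae_eq_of_le_open {g h : S → ℂ} (hg : Measurable[baire S, borel ℂ] g)
    (hh : Measurable[baire S, borel ℂ] h)
    (H : ∀ U : BorelSet ℂ, IsOpen U.1 → eventHom f (SigmaHom.preimage g hg U) ≤
      eventHom f (SigmaHom.preimage h hh U)) :
    g =ᵐ[S.meas] h :=
  ae_eq_of_comp_eq f hg hh (SigmaHom.eq_of_le_open H)

end AE

namespace CHProb

theorem Hom.measurePreserving {S T : CHProb.{u}} (a : S ⟶ T) :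
    MeasurePreserving a.toMap S.meas T.meas where
  measurable := measurable_baire a.toMap
  map_eq := by
    ext B hB
    rw [Measure.map_apply (measurable_baire a.toMap) hB]
    exact a.meas_preimage ⟨B, hB⟩

/-- Both `g` and `h` are continuous representatives of the bounded Baire function `h`, and such a
representative is unique. -/
theorem StrongLusin.eq_of_ae {S : CHProb.{u}} (hS : S.StrongLusin) {g h : C(S, ℂ)}
    (H : g =ᵐ[S.meas] h) : g = h :=
  (hS h (measurable_baire_complex h) ⟨‖h‖, h.norm_coe_le_norm⟩).unique H
    (Filter.EventuallyEq.refl _ _)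

/-- Existence and uniqueness are both transported by composing with the two mutually inverse maps,
which preserve null sets. -/
theorem StrongLusin.of_iso {S T : CHProb.{u}} (i : S ≅ T) (hT : T.StrongLusin) :
    S.StrongLusin := by
  have h1 : ∀ x : S, i.inv.toMap (i.hom.toMap x) = x := fun x =>
    congrArg (fun a : S ⟶ S => a.toMap x) i.hom_inv_id
  have h2 : ∀ x : T, i.hom.toMap (i.inv.toMap x) = x := fun x =>
    congrArg (fun a : T ⟶ T => a.toMap x) i.inv_hom_id
  rintro f hf ⟨M, hM⟩
  obtain ⟨g, hg, hgu⟩ := hT (f ∘ i.inv.toMap) (hf.comp (measurable_baire i.inv.toMap))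
    ⟨M, fun x => hM _⟩
  refine ⟨g.comp i.hom.toMap, ?_, fun g' hg' => ?_⟩
  · filter_upwards [(Hom.measurePreserving i.hom).quasiMeasurePreserving.ae hg] with x hx
    exact hx.trans (congrArg f (h1 x))
  · have := hgu (g'.comp i.inv.toMap)
      ((Hom.measurePreserving i.inv).quasiMeasurePreserving.ae hg')
    rw [← this]
    ext x
    simp [h1]

end CHProb

/-! ### The spectrum as a Stone space -/

/-- The law of an indicator is concentrated on `{0, 1}`, with mass `μ E` at `1`, so its mean is that
mass. -/
theorem trace_ind {A : Type u} [BooleanAlgebra A] (μ : ProbMeas A) (E : A) : trace μ (ind E) = ((μ E).toReal : ℂ) := by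
  have h1 : ∀ᵐ z : ℂ ∂(law μ (indHom E)), z = ({1} : Set ℂ).indicator (fun _ => (1 : ℂ)) z := by
    have hms : MeasurableSet (({1, 0} : Set ℂ)ᶜ) :=
      (((finite_singleton (0 : ℂ)).insert 1).measurableSet).compl
    have h0 : law μ (indHom E) ({1, 0} : Set ℂ)ᶜ = 0 := by
      rw [law_apply μ _ _ hms, indHom_apply, if_neg (by simp [toBorel]), if_neg (by simp [toBorel]),
        sup_bot_eq]
      exact μ.map_bot'
    rw [ae_iff]
    refine measure_mono_null (fun z hz => ?_) h0
    intro hz'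
    apply hz
    rcases hz' with rfl | rfl <;> simp
  rw [trace]
  change ∫ z, z ∂(law μ (indHom E)) = _
  rw [integral_congr_ae h1, integral_indicator_const _ (measurableSet_singleton _),
    measureReal_def, law_apply μ _ _ (measurableSet_singleton _), indHom_apply,
    if_pos (by simp [toBorel]), if_neg (by simp [toBorel]), sup_bot_eq]
  simp

section SpecStone

variable {A : Type u} [BooleanAlgebra A] [SigmaComplete A]

/-- Bounded abstractly measurable functions are the continuous functions on the Stone space. -/
def hatEquiv : LInf A ≃⋆ₐ[ℂ] C(StoneSp A, ℂ) where
  toFun := hat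
  invFun := ofCont
  left_inv := ofCont_hat
  right_inv := hat_ofCont
  map_mul' := hat_mul
  map_add' := hat_add
  map_star' := hat_star
  map_smul' := hat_smul

/-- The Gelfand spectrum is the Stone space of the algebra of events. -/
def stoneSpec : StoneSp A ≃ₜ Spec A where
  toFun z := compContinuousMap (hatEquiv (A := A) : LInf A →⋆ₐ[ℂ] C(StoneSp A, ℂ))
    (homeoEval (StoneSp A) ℂ z)
  invFun χ := (homeoEval (StoneSp A) ℂ).symm
    (compContinuousMap (hatEquiv (A := A).symm : C(StoneSp A, ℂ) →⋆ₐ[ℂ] LInf A) χ)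
  left_inv z := by
    rw [Homeomorph.symm_apply_eq]
    refine WeakDual.CharacterSpace.ext fun g => ?_
    change hat (ofCont g) z = g z
    rw [hat_ofCont]
  right_inv χ := by
    simp only [Homeomorph.apply_symm_apply]
    refine WeakDual.CharacterSpace.ext fun f => ?_
    change χ (ofCont (hat f)) = χ f
    rw [ofCont_hat]
  continuous_toFun := (map_continuous _).comp (homeoEval (StoneSp A) ℂ).continuous
  continuous_invFun := (homeoEval (StoneSp A) ℂ).symm.continuous.comp (map_continuous _)

theorem stoneSpec_apply (z : StoneSp A) (f : LInf A) : stoneSpec z f = hat f z := rfl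

theorem stoneSpec_ind_eq_one {z : StoneSp A} {E : A} :
    stoneSpec z (ind E) = 1 ↔ z ∈ basic E := by
  classical
  rw [stoneSpec_apply, hat_ind]
  split_ifs with h <;> simp [h]

/-- The characters at which the indicator function of `E` has the value `1`. -/
def specSet (E : A) : Set (Spec A) := {χ | χ (ind E) = 1}

theorem stoneSpec_mem_specSet {z : StoneSp A} {E : A} :
    stoneSpec z ∈ specSet E ↔ z ∈ basic E := stoneSpec_ind_eq_one

theorem specSet_eq_image (E : A) : specSet E = stoneSpec '' basic E := by
  ext χ
  obtain ⟨z, rfl⟩ := stoneSpec.surjective χ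
  rw [stoneSpec.injective.mem_set_image, stoneSpec_mem_specSet]

theorem isClopen_specSet (E : A) : IsClopen (specSet E) := by
  rw [specSet_eq_image]
  exact ⟨stoneSpec.isClosed_image.2 (isClopen_basic E).1, stoneSpec.isOpen_image.2 (isClopen_basic E).2⟩

/-- The indicator of this clopen set is continuous and is the Gelfand transform of `ind E`. The
Riesz measure therefore integrates it to the trace of `ind E`. -/
theorem rieszBorel_specSet (μ : ProbMeas A) (E : A) : rieszBorel μ (specSet E) = μ E := by
  let _ : MeasurableSpace (Spec A) := borel _
  have _ : BorelSpace (Spec A) := ⟨rfl⟩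
  have hK : IsClopen (specSet E) := isClopen_specSet E
  let g : C(Spec A, ℝ) := ⟨(specSet E).indicator fun _ => 1,
    (IsLocallyConstant.const 1).continuous.indicator (by simp [hK.frontier_eq])⟩
  have hg : gelfandInv g = ind E := by
    rw [gelfandInv, StarAlgEquiv.symm_apply_eq]
    ext χ
    obtain ⟨z, rfl⟩ := stoneSpec.surjective χ
    classical
    change (((specSet E).indicator (fun _ => (1 : ℝ)) (stoneSpec z) : ℝ) : ℂ) = hat (ind E) z
    rw [hat_ind, indicator_apply]
    simp only [stoneSpec_mem_specSet]
    split_ifs <;> simp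
  have hle : μ E ≠ ⊤ := ne_top_of_le_ne_top ENNReal.one_ne_top (μ.le_one E)
  have h1 : ∫ χ, (specSet E).indicator (fun _ => (1 : ℝ)) χ ∂(rieszBorel μ) = (μ E).toReal := by
    refine (RealRMK.integral_rieszMeasure (spectralFunctional μ)
      (CompactlySupportedContinuousMap.continuousMapEquiv g)).trans ?_
    change (trace μ (gelfandInv g)).re = _
    rw [hg, trace_ind, Complex.ofReal_re]
  have hfin : rieszBorel μ (specSet E) ≠ ⊤ := by
    have h2 := (rieszBaire_prob μ).measure_univ
    rw [rieszBaire, trim_measurableSet_eq _ MeasurableSet.univ] at h2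
    exact ne_top_of_le_ne_top ENNReal.one_ne_top (h2 ▸ measure_mono (subset_univ _))
  rw [integral_indicator_const _ hK.1.measurableSet, smul_eq_mul, mul_one, measureReal_def] at h1
  exact (ENNReal.toReal_eq_toReal_iff' hfin hle).1 h1

end SpecStone

/-! ### Events as clopen sets of the canonical model, and its strong Lusin property -/

section StoneEvents

variable {X : ProbAlg.{u}}

theorem stoneSpec_mem_stoneSet {z : StoneSp X.Events} {E : X.Events} :
    (show Stone X from stoneSpec z) ∈ (stoneSet E).1 ↔ z ∈ basic E := stoneSpec_ind_eq_one

theorem stoneSet_sup (E F : X.Events) : stoneSet (E ⊔ F) = stoneSet E ⊔ stoneSet F := by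
  refine Subtype.ext ((specSet_eq_image (E ⊔ F)).trans ?_)
  rw [basic_sup, image_union, ← specSet_eq_image, ← specSet_eq_image]
  rfl

theorem stoneSet_inf (E F : X.Events) : stoneSet (E ⊓ F) = stoneSet E ⊓ stoneSet F := by
  refine Subtype.ext ((specSet_eq_image (E ⊓ F)).trans ?_)
  rw [basic_inf, image_inter stoneSpec.injective, ← specSet_eq_image, ← specSet_eq_image]
  rfl

theorem stoneSet_bot : stoneSet (⊥ : X.Events) = ⊥ := by
  refine Subtype.ext ((specSet_eq_image (⊥ : X.Events)).trans ?_)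
  rw [basic_bot, image_empty]
  rfl

theorem stoneSet_top : stoneSet (⊤ : X.Events) = ⊤ := by
  refine Subtype.ext ((specSet_eq_image (⊤ : X.Events)).trans ?_)
  rw [basic_top, image_univ, stoneSpec.surjective.range_eq]
  rfl

theorem stoneSet_mono {E F : X.Events} (h : E ≤ F) : (stoneSet E).1 ⊆ (stoneSet F).1 := by
  refine ((specSet_eq_image E).le.trans ?_).trans (specSet_eq_image F).ge
  exact image_mono (basic_mono h)

theorem meas_stoneSet (E : X.Events) : (Stone X).meas (stoneSet E).1 = X.obj.prob E :=
  (trim_measurableSet_eq (baire_le_borel (Spec X.Events)) (stoneSet E).2).trans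
    (rieszBorel_specSet _ E)

/-- The set attached to a countable join differs from the union by a null set. -/
theorem meas_stoneSet_diff {s : ℕ → X.Events} {a : X.Events} (h : IsLUB (range s) a) :
    (Stone X).meas ((stoneSet a).1 \ ⋃ n, (stoneSet (s n)).1) = 0 := by
  -- After disjointing the sequence, countable additivity on both sides shows that the union of the
  -- clopen sets already has the full measure of `a`.
  have hd := fun m n (hmn : m ≠ n) => (disjoint_disjointed s hmn).eq_bot
  have hsub : (⋃ n, (stoneSet (disjointed s n)).1) ⊆ (stoneSet a).1 :=
    iUnion_subset fun n => stoneSet_mono ((disjointed_le s n).trans (h.1 ⟨n, rfl⟩))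
  have h1 : (Stone X).meas (⋃ n, (stoneSet (disjointed s n)).1) = X.obj.prob a := by
    rw [measure_iUnion (fun m n hmn => ?_) fun n => (stoneSet (disjointed s n)).2,
      X.obj.prob.map_isLUB' _ a hd (ProbMeas.isLUB_disjointed h)]
    · simp only [meas_stoneSet]
    · rw [Function.onFun, Set.disjoint_iff_inter_eq_empty]
      have := stoneSet_inf (disjointed s m) (disjointed s n)
      rw [hd m n hmn, stoneSet_bot] at this
      exact (congrArg Subtype.val this).symm
  have hm : MeasurableSet (⋃ n, (stoneSet (disjointed s n)).1) :=
    MeasurableSet.iUnion fun n => (stoneSet (disjointed s n)).2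
  refine measure_mono_null (sdiff_subset_sdiff_right
    (iUnion_mono fun n => stoneSet_mono (disjointed_le s n))) ?_
  rw [measure_sdiff hsub hm.nullMeasurableSet (measure_ne_top _ _), h1, meas_stoneSet, tsub_self]

/-- The class of the set of characters attached to an event. -/
def stoneHom (X : ProbAlg.{u}) :
    SigmaHom X.Events (CHProb.toAbsProb.obj (Stone X)).prob.NullQuot where
  toFun E := ProbMeas.NullQuot.mk _ (stoneSet E)
  map_sup' E F := by rw [stoneSet_sup]; rfl
  map_inf' E F := by rw [stoneSet_inf]; rfl
  map_top' := by rw [stoneSet_top]; rfl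
  map_bot' := by rw [stoneSet_bot]; rfl
  map_isLUB' s a h := by
    constructor
    · rintro _ ⟨n, rfl⟩
      exact ProbMeas.NullQuot.mk_mono (stoneSet_mono (h.1 ⟨n, rfl⟩))
    · intro q hq
      induction q using ProbMeas.NullQuot.ind with | h V =>
      have h1 : ∀ n, (Stone X).meas ((stoneSet (s n)).1 \ V.1) = 0 := fun n =>
        ProbMeas.NullQuot.mk_le_mk.1 (hq ⟨n, rfl⟩)
      refine ProbMeas.NullQuot.mk_le_mk.2 ?_
      change (Stone X).meas ((stoneSet a).1 \ V.1) = 0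
      -- The clopen set of a join may exceed the union of the clopen sets, but only by a null set,
      -- which the quotient ignores.
      refine measure_mono_null (t := ((stoneSet a).1 \ ⋃ n, (stoneSet (s n)).1) ∪
        ⋃ n, (stoneSet (s n)).1 \ V.1) (fun x hx => ?_)
        (measure_union_null (meas_stoneSet_diff h) (measure_iUnion_null h1))
      by_cases hxs : x ∈ ⋃ n, (stoneSet (s n)).1
      · obtain ⟨n, hn⟩ := mem_iUnion.1 hxs
        exact Or.inr (mem_iUnion.2 ⟨n, hn, hx.2⟩)
      · exact Or.inl ⟨hx.1, hxs⟩

/-- An open subset of `ℂ` is a countable union of closed sets. Each has compact preimage, so a basic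
clopen set fits between it and the preimage of `U`. -/
theorem bairePre_stone_eq_iUnion (g : C(Spec X.Events, ℂ)) (U : BorelSet ℂ) (hU : IsOpen U.1) :
    ∃ s : ℕ → X.Events, (bairePre g U).1 = ⋃ n, (stoneSet (s n)).1 := by
  obtain ⟨F, hF, hFU, hFe, -⟩ := hU.exists_iUnion_isClosed
  let k : C(StoneSp X.Events, ℂ) := g.comp ⟨stoneSpec, stoneSpec.continuous⟩
  have h1 : ∀ n, ∃ a : X.Events, k ⁻¹' F n ⊆ basic a ∧ basic a ⊆ k ⁻¹' U.1 := fun n =>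
    exists_basic_between ((hF n).preimage k.continuous).isCompact (hU.preimage k.continuous)
      (preimage_mono (hFU n))
  choose s hs hs' using h1
  refine ⟨s, ?_⟩
  ext χ
  obtain ⟨z, rfl⟩ := stoneSpec.surjective χ
  refine Iff.trans ?_ mem_iUnion.symm
  refine Iff.trans ?_ (exists_congr fun n => stoneSpec_mem_stoneSet (E := s n)).symm
  change k z ∈ U.1 ↔ _
  constructor
  · intro hz
    rw [← hFe] at hz
    obtain ⟨n, hn⟩ := mem_iUnion.1 hz
    exact ⟨n, hs n hn⟩
  · rintro ⟨n, hn⟩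
    exact hs' n hn

theorem SigmaHom.ext_stone {A : Type v} [BooleanAlgebra A] {α β : SigmaHom (Stone X).BaireSet A}
    (h : ∀ E, α (stoneSet E) = β (stoneSet E)) : α = β := by
  refine SigmaHom.ext_baire fun g U hU => ?_
  obtain ⟨s, hs⟩ := bairePre_stone_eq_iUnion g U hU
  have hl : IsLUB (range fun n => (stoneSet (s n) : (Stone X).BaireSet)) (bairePre g U) :=
    (MeasSet.isLUB_iff _ _).2 hs
  have h1 := α.map_isLUB hl
  simp only [h] at h1
  exact h1.unique (β.map_isLUB hl)

/-- Injectivity holds because the map preserves measure and nonzero events of `X` have positive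
measure. For surjectivity, the classes in the range are closed under complements and countable
joins, and contain the generating Baire sets, which are countable unions of clopen sets of events.
-/
theorem stoneHom_bijective (X : ProbAlg.{u}) : Function.Bijective (stoneHom X) := by
  constructor
  · intro E F hEF
    refine symmDiff_eq_bot.1 (ProbAlg.eq_bot_of_prob ?_)
    have h1 : stoneHom X (symmDiff E F) = ⊥ := by rw [map_symmDiff', hEF, symmDiff_self]
    have h2 := congrArg (CHProb.toAbsProb.obj (Stone X)).prob.quotMeas.toFun h1
    rw [← meas_stoneSet]
    exact h2.trans (ProbMeas.map_bot' _)
  · intro q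
    induction q using ProbMeas.NullQuot.ind with | h B =>
    change (Stone X).BaireSet at B
    induction B using baire_induction with
    | ho g U hU =>
      obtain ⟨s, hs⟩ := bairePre_stone_eq_iUnion g U hU
      obtain ⟨a, ha⟩ := SigmaComplete.exists_isLUB s
      exact ⟨a, ((stoneHom X).map_isLUB ha).unique
        (ProbMeas.NullQuot.isLUB_mk ((MeasSet.isLUB_iff _ _).2 hs))⟩
    | hc B ih =>
      obtain ⟨E, hE⟩ := ih
      exact ⟨Eᶜ, by rw [map_compl', hE]; rfl⟩
    | hu s a ha ih =>
      choose t ht using ih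
      obtain ⟨E, hE⟩ := SigmaComplete.exists_isLUB t
      refine ⟨E, ((stoneHom X).map_isLUB hE).unique ?_⟩
      simp only [ht]
      exact ProbMeas.NullQuot.isLUB_mk ha

/-- The natural isomorphism of a probability algebra with that of its canonical model. -/
def stoneIso (X : ProbAlg.{u}) : X ≅ (Stone X).toProbAlg :=
  (ProbAlg.isoOfBijective (X := (Stone X).toProbAlg) (Y := X) (stoneHom X) (stoneHom_bijective X)
    meas_stoneSet).symm

theorem isNaturalIso_stoneIso (X : ProbAlg.{u}) : IsNaturalIso (stoneIso X) := fun _ => rfl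

theorem IsNaturalIso.eventHom_stoneSet {e : X ≅ (Stone X).toProbAlg} (he : IsNaturalIso e)
    (E : X.Events) : eventHom (inclOfIso e) (stoneSet E) = E := by
  refine Eq.trans ?_ (iso_pullback_hom_inv e E)
  rw [he E]
  rfl

/-- A bounded Baire function `f` pulls back to an element `J` of `LInf X.Events`, and the Gelfand
transform of `J` is the continuous representative. It is unique because every nonempty open set
contains a nonempty basic clopen set, which has positive measure. -/
theorem stone_strongLusin (X : ProbAlg.{u}) : (Stone X).StrongLusin := by
  have he := (isNaturalIso_stoneIso X).eventHom_stoneSet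
  set φ := inclOfIso (stoneIso X)
  rintro f hf ⟨M, hM⟩
  let J : LInf X.Events := ⟨(eventHom φ).comp (SigmaHom.preimage f hf), M, by
    rw [SigmaHom.comp_apply, ← map_top (eventHom φ)]
    exact congrArg (eventHom φ) (Subtype.ext (eq_univ_of_forall hM))⟩
  let g : C(Spec X.Events, ℂ) := WeakDual.gelfandTransform ℂ (LInf X.Events) J
  have hg : g =ᵐ[(Stone X).meas] f := by
    refine ae_eq_of_le_open φ (measurable_baire_complex g) hf fun U hU => ?_
    -- For open `U` the set where `g` lies in `U` is only included in the clopen set of `J U`; the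
    -- inequality is enough for `ae_eq_of_le_open`.
    have h1 : SigmaHom.preimage g (measurable_baire_complex g) U ≤ stoneSet (J U) := by
      intro χ hχ
      obtain ⟨z, rfl⟩ := stoneSpec.surjective χ
      exact stoneSpec_mem_stoneSet.2 (mem_basic_of_open J hU hχ)
    exact (OrderHomClass.mono (eventHom φ) h1).trans (he (J U)).le
  refine ⟨g, hg, fun g' hg' => ?_⟩
  have hae : g' =ᵐ[(Stone X).meas] g := Filter.EventuallyEq.trans hg' hg.symm
  by_contra hne
  obtain ⟨χ, hχ⟩ := DFunLike.ne_iff.1 hne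
  obtain ⟨z, rfl⟩ := stoneSpec.surjective χ
  obtain ⟨a, ha, hag⟩ := exists_basic_between (isCompact_singleton (x := z))
    (U := {y | g' (stoneSpec y) ≠ g (stoneSpec y)})
    (isOpen_ne_fun (g'.continuous.comp stoneSpec.continuous)
      (g.continuous.comp stoneSpec.continuous)) (singleton_subset_iff.2 hχ)
  have h0 : X.obj.prob a = 0 := by
    rw [← meas_stoneSet]
    refine measure_mono_null (fun χ hχ => ?_) (ae_iff.1 hae)
    obtain ⟨y, rfl⟩ := stoneSpec.surjective χ
    exact hag (stoneSpec_mem_stoneSet.1 hχ)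
  have h1 := ha rfl
  rw [ProbAlg.eq_bot_of_prob h0, basic_bot] at h1
  exact h1

end StoneEvents

/-! ### Initial models -/

/-! ### Limits of ultrafilters in a compact space -/

section ToModel

variable {A : Type u} [BooleanAlgebra A] {N : Type v} [TopologicalSpace N] [CompactSpace N]
  (φ : SigmaHom (MeasSet N (baire N)) A)

/-- Pulling `z` back along `φ` gives an ultrafilter of Baire sets, and compactness makes it
converge. Otherwise each point has a neighbourhood outside the ultrafilter; finitely many cover `N`,
yet `φ ⊤ = ⊤` belongs to every ultrafilter. -/
theorem exists_limit (z : StoneSp A) : ∃ y : N, ∀ (g : C(N, ℂ)) (U : BorelSet ℂ), IsOpen U.1 →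
    g y ∈ U.1 → z ∈ basic (φ (bairePre g U)) := by
  by_contra! hcon
  choose g U hU hy hz using hcon
  obtain ⟨B, hB, hzB⟩ : ∃ B : MeasSet N (baire N), univ ⊆ B.1 ∧ z ∉ basic (φ B) := by
    refine (isCompact_univ (X := N)).induction_on
      (p := fun s => ∃ B : MeasSet N (baire N), s ⊆ B.1 ∧ z ∉ basic (φ B)) ?_ ?_ ?_ ?_
    · exact ⟨⊥, empty_subset _, by rw [map_bot, basic_bot]; exact notMem_empty _⟩
    · rintro s t hst ⟨B, h1, h2⟩
      exact ⟨B, hst.trans h1, h2⟩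
    · rintro s t ⟨B, h1, h2⟩ ⟨C, h3, h4⟩
      refine ⟨B ⊔ C, union_subset_union h1 h3, ?_⟩
      rw [map_sup, basic_sup]
      exact fun h => h.elim h2 h4
    · intro y _
      exact ⟨_, mem_nhdsWithin_of_mem_nhds (((hU y).preimage (g y).continuous).mem_nhds (hy y)),
        bairePre (g y) (U y), Subset.rfl, hz y⟩
  have : B = ⊤ := Subtype.ext (univ_subset_iff.1 hB)
  rw [this, map_top, basic_top] at hzB
  exact hzB trivial

/-- The limit in `N` of the ultrafilter of Baire sets given by a point of the Stone space. -/
def limitFun (z : StoneSp A) : N := (exists_limit φ z).choose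

theorem mem_basic_of_limitFun {z : StoneSp A} {g : C(N, ℂ)} {U : BorelSet ℂ} (hU : IsOpen U.1)
    (h : g (limitFun φ z) ∈ U.1) : z ∈ basic (φ (bairePre g U)) :=
  (exists_limit φ z).choose_spec g U hU h

theorem limitFun_mem_of_closed {z : StoneSp A} {g : C(N, ℂ)} {B : BorelSet ℂ}
    (hB : IsClosed B.1) (h : z ∈ basic (φ (bairePre g B))) : g (limitFun φ z) ∈ B.1 := by
  by_contra hn
  have h1 := mem_basic_of_limitFun φ (U := Bᶜ) hB.isOpen_compl hn
  rw [map_compl', map_compl', basic_compl] at h1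
  exact h1 h

/-- The map from the Stone space of the algebra to a compact Hausdorff space induced by a morphism
from its Baire algebra. -/
def limitMap [T2Space N] : C(StoneSp A, N) where
  toFun := limitFun φ
  continuous_toFun := by
    rw [continuous_iff_continuousAt]
    intro z W hW
    obtain ⟨V, hVW, hV, hzV⟩ := mem_nhds_iff.1 hW
    -- A Urysohn function vanishing at the limit point and equal to `1` off `V`: on a clopen
    -- neighbourhood of `z` its value at the limit has norm at most `1 / 2`, so the limit stays in
    -- `V`.
    obtain ⟨g, hg0, hg1, -⟩ := exists_continuous_zero_one_of_isClosed
      (isClosed_singleton (x := limitFun φ z)) hV.isClosed_compl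
      (Set.disjoint_left.2 fun y hy hy' => hy' (by rwa [mem_singleton_iff.1 hy]))
    let k : C(N, ℂ) := ⟨fun y => (g y : ℂ), by fun_prop⟩
    have hz : z ∈ basic (φ (bairePre k (ballSet 0 (1 / 2)))) := by
      refine mem_basic_of_limitFun φ Metric.isOpen_ball ?_
      have : k (limitFun φ z) = 0 := by simp [k, hg0 rfl]
      rw [this]
      exact Metric.mem_ball_self (by norm_num)
    rw [Filter.mem_map]
    refine Filter.mem_of_superset ((isClopen_basic _).2.mem_nhds hz) fun z' hz' => hVW ?_
    have h1 : k (limitFun φ z') ∈ (cballSet 0 (1 / 2)).1 :=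
      limitFun_mem_of_closed φ Metric.isClosed_closedBall (basic_mono (OrderHomClass.mono φ
        (OrderHomClass.mono (bairePre k)
          (show ballSet 0 (1 / 2) ≤ cballSet 0 (1 / 2) from Metric.ball_subset_closedBall))) hz')
    by_contra hn
    have h2 : k (limitFun φ z') = 1 := by simp [k, hg1 hn]
    rw [h2] at h1
    have h3 : dist (1 : ℂ) 0 ≤ 1 / 2 := h1
    norm_num at h3

theorem limitMap_preimage [T2Space N] {g : C(N, ℂ)} {U : BorelSet ℂ} (hU : IsOpen U.1) :
    limitMap φ ⁻¹' (bairePre g U).1 ⊆ basic (φ (bairePre g U)) := fun _ hz =>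
  mem_basic_of_limitFun φ hU hz

end ToModel

/-! ### From strong Lusin spaces to the Stone space -/

section FromLusin

variable {X : ProbAlg.{u}} {S : CHProb.{u}} (f : Inc.obj X ⟶ CHProb.toAbsProb.obj S)

/-- In a space with the strong Lusin property, the events have continuous indicator functions. -/
theorem CHProb.StrongLusin.exists_indicator (hS : S.StrongLusin)
    (hf : Function.Surjective (eventHom f)) (E : X.Events) :
    ∃ g : C(S, ℂ), ∀ B : S.BaireSet, eventHom f B = E →
      g =ᵐ[S.meas] B.1.indicator (fun _ => (1 : ℂ)) := by
  obtain ⟨B, hB⟩ := hf E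
  obtain ⟨g, hg, -⟩ := hS (B.1.indicator fun _ => (1 : ℂ))
    (by borelize ℂ; exact measurable_const.indicator B.2)
    ⟨1, fun x => (norm_indicator_le_norm_self _ x).trans (by simp)⟩
  refine ⟨g, fun C hC => Filter.EventuallyEq.trans hg ?_⟩
  have h1 := (eventHom_eq_iff f).1 (hB.trans hC.symm)
  exact indicator_ae_eq_of_ae_eq_set h1

variable (hS : S.StrongLusin) (hf : Function.Surjective (eventHom f))

/-- The continuous indicator function of an event. -/
def contInd (E : X.Events) : C(S, ℂ) := (hS.exists_indicator f hf E).choose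

theorem contInd_ae (B : S.BaireSet) :
    contInd f hS hf (eventHom f B) =ᵐ[S.meas] B.1.indicator (fun _ => (1 : ℂ)) :=
  (hS.exists_indicator f hf _).choose_spec B rfl

/-- The identity is clear almost everywhere for indicator functions; as both sides are continuous,
strong Lusin makes it hold at every point. Complements and `⊤` are treated in the same way, so that
evaluation at a point becomes a Boolean homomorphism. -/
theorem contInd_inf (E F : X.Events) :
    contInd f hS hf (E ⊓ F) = contInd f hS hf E * contInd f hS hf F := by
  obtain ⟨B, rfl⟩ := hf E
  obtain ⟨C, rfl⟩ := hf F
  rw [← map_inf]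
  refine hS.eq_of_ae ?_
  filter_upwards [contInd_ae f hS hf (B ⊓ C), contInd_ae f hS hf B, contInd_ae f hS hf C]
    with x h1 h2 h3
  refine h1.trans (Eq.trans ?_ (congrArg₂ (· * ·) h2 h3).symm)
  change (B.1 ∩ C.1).indicator _ x = _
  by_cases hB : x ∈ B.1 <;> by_cases hC : x ∈ C.1 <;> simp [hB, hC]

theorem contInd_compl (E : X.Events) : contInd f hS hf Eᶜ = 1 - contInd f hS hf E := by
  classical
  obtain ⟨B, rfl⟩ := hf E
  rw [← map_compl']
  refine hS.eq_of_ae ?_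
  filter_upwards [contInd_ae f hS hf Bᶜ, contInd_ae f hS hf B] with x h1 h2
  refine h1.trans (Eq.trans ?_ (congrArg (1 - ·) h2).symm)
  change (B.1ᶜ).indicator _ x = _
  by_cases hx : x ∈ B.1 <;> simp [hx]

theorem contInd_top : contInd f hS hf ⊤ = 1 := by
  rw [← map_top (eventHom f)]
  refine hS.eq_of_ae ?_
  filter_upwards [contInd_ae f hS hf ⊤] with x h1
  refine h1.trans ?_
  change (univ : Set S).indicator _ x = _
  simp

/-- Because `E ⊓ E = E`, the function is idempotent. -/
theorem contInd_apply (E : X.Events) (x : S) :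
    contInd f hS hf E x = 0 ∨ contInd f hS hf E x = 1 := by
  have h := DFunLike.congr_fun (contInd_inf f hS hf E E) x
  rw [inf_idem] at h
  have h1 : contInd f hS hf E x * (contInd f hS hf E x - 1) = 0 := by
    rw [mul_sub, mul_one, sub_eq_zero]
    exact h.symm
  exact (mul_eq_zero.1 h1).imp_right sub_eq_zero.1

theorem contInd_inf_eq_one (E F : X.Events) (x : S) : contInd f hS hf (E ⊓ F) x = 1 ↔
    contInd f hS hf E x = 1 ∧ contInd f hS hf F x = 1 := by
  rw [contInd_inf, ContinuousMap.mul_apply]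
  rcases contInd_apply f hS hf E x with h | h <;> rcases contInd_apply f hS hf F x with h' | h' <;>
    simp [h, h']

theorem contInd_compl_eq_one (E : X.Events) (x : S) : contInd f hS hf Eᶜ x = 1 ↔
    ¬ contInd f hS hf E x = 1 := by
  rw [contInd_compl, ContinuousMap.sub_apply, ContinuousMap.one_apply]
  rcases contInd_apply f hS hf E x with h | h <;> simp [h]

theorem contInd_sup_eq_one (E F : X.Events) (x : S) : contInd f hS hf (E ⊔ F) x = 1 ↔
    contInd f hS hf E x = 1 ∨ contInd f hS hf F x = 1 := by
  rw [← _root_.compl_compl (E ⊔ F), compl_sup, contInd_compl_eq_one, contInd_inf_eq_one,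
    contInd_compl_eq_one, contInd_compl_eq_one]
  tauto

open Classical in
/-- The map from a space with the strong Lusin property to the Stone space of its probability
algebra. -/
def toStoneSp : C(S, StoneSp X.Events) where
  toFun x := ⟨fun E => decide (contInd f hS hf E x = 1), by
    rw [decide_eq_false_iff_not, ← compl_top, contInd_compl_eq_one, contInd_top]
    simp, by simp [contInd_top], fun a b => by
      simp [contInd_sup_eq_one], fun a b => by simp [contInd_inf_eq_one]⟩
  continuous_toFun := by
    refine Continuous.subtype_mk (continuous_pi fun E => ?_) _
    have hc : Continuous (contInd f hS hf E) := (contInd f hS hf E).continuous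
    -- With only the values `0` and `1`, the closed condition of being `1` is also the open
    -- condition of not being `0`.
    have h0 : {x : S | contInd f hS hf E x = 1} = {x | contInd f hS hf E x ≠ 0} := by
      ext x
      rcases contInd_apply f hS hf E x with h | h <;> simp [h]
    have h1 : IsClopen {x : S | contInd f hS hf E x = 1} :=
      ⟨isClosed_eq hc continuous_const, h0 ▸ isOpen_ne_fun hc continuous_const⟩
    convert (continuous_boolIndicator_iff_isClopen _).2 h1 using 2 with x
    simp [boolIndicator]

theorem mem_toStoneSp {E : X.Events} {x : S} :
    toStoneSp f hS hf x ∈ basic E ↔ contInd f hS hf E x = 1 := decide_eq_true_iff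

/-- Write `E` as the event of a Baire set `C`. On `B` the continuous indicator of `E` equals `1`,
while almost everywhere it is the indicator of `C`; hence `B \ C` is null. -/
theorem eventHom_le_of_subset {B : S.BaireSet} {E : X.Events}
    (h : B.1 ⊆ toStoneSp f hS hf ⁻¹' basic E) : eventHom f B ≤ E := by
  obtain ⟨C, rfl⟩ := hf E
  have h1 : eventHom f (B \ C) = ⊥ := by
    rw [← map_bot (eventHom f), eventHom_eq_iff]
    change (B.1 \ C.1 : Set S) =ᵐ[S.meas] (∅ : Set S)
    rw [ae_eq_empty]
    refine measure_mono_null (fun x hx => ?_) (ae_iff.1 (contInd_ae f hS hf C))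
    intro hx'
    have h2 : contInd f hS hf (eventHom f C) x = 1 := (mem_toStoneSp f hS hf).1 (h hx.1)
    rw [h2, indicator_of_notMem hx.2] at hx'
    exact one_ne_zero hx'
  rwa [map_sdiff', sdiff_eq_bot_iff] at h1

end FromLusin

theorem Model.surjective {X : ProbAlg.{u}} (M : Model X) : Function.Surjective (eventHom M.incl) :=
  (mono_iff_surjective M.incl).1 M.mono

/-! ### Morphisms out of a strong Lusin model -/

section Initial

variable {X : ProbAlg.{u}} {M N : Model X}

/-- Preservation of measure is automatic: both measures are read off from that of `X`. -/
theorem Model.exists_hom_of_comp_eq (T : C(M.space, N.space))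
    (h : (eventHom M.incl).comp (SigmaHom.preimage T (measurable_baire T)) = eventHom N.incl) :
    ∃ a : M ⟶ N, a.toCHProb.toMap = T := by
  have hm : ∀ B : N.space.BaireSet, M.space.meas (T ⁻¹' B.1) = N.space.meas B.1 := fun B => by
    rw [← prob_eventHom N.incl, ← h]
    exact (prob_eventHom M.incl ⟨T ⁻¹' B.1, measurable_baire T B.2⟩).symm
  exact ⟨⟨⟨T, hm⟩, AbsProb.hom_ext (DFunLike.congr_fun h)⟩, rfl⟩

theorem Model.Hom.eventHom_comp (a : M ⟶ N) :
    (eventHom M.incl).comp (SigmaHom.preimage a.toCHProb.toMap (measurable_baire _)) =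
      eventHom N.incl :=
  SigmaHom.ext fun B => congrArg (fun i => AbsProb.Hom.pullback i B) a.comm

/-- A point of `M` determines an ultrafilter of events of `X`, which pulls back to an ultrafilter of
Baire sets of `N` and is sent to its limit. Compatibility with the inclusions is first obtained as
an inequality on preimages of open sets, and `SigmaHom.ext_baire_of_le` makes it an equality. -/
theorem Model.exists_hom (hM : M.space.StrongLusin) (N : Model X) : Nonempty (M ⟶ N) := by
  let p := toStoneSp M.incl hM M.surjective
  let T : C(M.space, N.space) := (limitMap (eventHom N.incl)).comp p
  have h : (eventHom M.incl).comp (SigmaHom.preimage T (measurable_baire T)) =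
      eventHom N.incl := SigmaHom.ext_baire_of_le fun g U hU =>
    eventHom_le_of_subset M.incl hM M.surjective
      (preimage_mono (f := p) (limitMap_preimage (eventHom N.incl) hU))
  obtain ⟨a, -⟩ := Model.exists_hom_of_comp_eq T h
  exact ⟨a⟩

/-- Composites of two morphisms with a continuous function on `N` have the same pullback to `X`, so
they agree almost everywhere and then, by strong Lusin, everywhere. Urysohn functions separate the
points of `N`. -/
theorem Model.hom_unique (hM : M.space.StrongLusin) (a b : M ⟶ N) : a = b := by
  refine Model.Hom.ext (CHProb.Hom.ext (ContinuousMap.ext fun x => ?_))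
  by_contra hne
  obtain ⟨g, hg0, hg1, -⟩ := exists_continuous_zero_one_of_isClosed
    (isClosed_singleton (x := a.toCHProb.toMap x)) (isClosed_singleton (x := b.toCHProb.toMap x))
    (by simpa using hne)
  let k : C(N.space, ℂ) := ⟨fun y => (g y : ℂ), by fun_prop⟩
  have h1 : k.comp a.toCHProb.toMap = k.comp b.toCHProb.toMap := by
    refine hM.eq_of_ae (ae_eq_of_comp_eq M.incl (measurable_baire_complex _)
      (measurable_baire_complex _) (SigmaHom.ext fun U => ?_))
    exact DFunLike.congr_fun ((Model.Hom.eventHom_comp a).trans (Model.Hom.eventHom_comp b).symm)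
      (bairePre k U)
  have h2 := DFunLike.congr_fun h1 x
  have h3 : k (a.toCHProb.toMap x) = 0 := by simp [k, hg0 rfl]
  have h4 : k (b.toCHProb.toMap x) = 1 := by simp [k, hg1 rfl]
  exact zero_ne_one (h3.symm.trans (h2.trans h4))

theorem Model.nonempty_isInitial (hM : M.space.StrongLusin) : Nonempty (Limits.IsInitial M) :=
  ⟨Limits.IsInitial.ofUniqueHom (fun N => (Model.exists_hom hM N).some)
    fun _ _ => Model.hom_unique hM _ _⟩

/-- The functor taking a model to its space. -/
def Model.forget (X : ProbAlg.{u}) : Model X ⥤ CHProb.{u} where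
  obj M := M.space
  map a := a.toCHProb

end Initial

/-! ### Naturality of the canonical model -/

section Naturality

variable {X Y : ProbAlg.{u}}

/-- The map of Stone spaces dual to a Boolean homomorphism. -/
def StoneSp.comap {A : Type u} {B : Type v} [BooleanAlgebra A] [BooleanAlgebra B]
    (f : SigmaHom A B) : C(StoneSp B, StoneSp A) where
  toFun z := ⟨fun a => z.1 (f a), (congrArg z.1 (map_bot f)).trans z.2.1,
    (congrArg z.1 (map_top f)).trans z.2.2.1,
    fun a b => (congrArg z.1 (map_sup f a b)).trans (z.2.2.2.1 _ _),
    fun a b => (congrArg z.1 (map_inf f a b)).trans (z.2.2.2.2 _ _)⟩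
  continuous_toFun := Continuous.subtype_mk
    (continuous_pi fun a => StoneSp.continuous_apply (f a)) _

/-- A value of `hat` is pinned down by small balls: the event that `f` is within `ε` of its value at
the dual point belongs to that ultrafilter, hence its pullback belongs to `z`. -/
theorem hat_koopman (π : X ⟶ Y) (f : LInf Y.Events) (z : StoneSp X.Events) :
    hat (koopman π f) z = hat f (StoneSp.comap (Inc.map π).pullback z) := by
  set z' := StoneSp.comap (Inc.map π).pullback z
  rw [← dist_le_zero]
  refine le_of_forall_pos_le_add fun ε hε => ?_
  rw [zero_add]
  refine hat_mem_of_closed (koopman π f) (B := cballSet (hat f z') ε) Metric.isClosed_closedBall ?_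
  have h1 : z' ∈ basic (f.1 (ballSet (hat f z') ε)) :=
    mem_basic_of_open f Metric.isOpen_ball (Metric.mem_ball_self hε)
  exact basic_mono (OrderHomClass.mono f.1
    (show ballSet (hat f z') ε ≤ cballSet (hat f z') ε from Metric.ball_subset_closedBall)) h1

/-- The map of spectra dual to the Koopman operator. -/
def specMap (π : X ⟶ Y) : C(Spec X.Events, Spec Y.Events) :=
  ⟨fun χ => stoneSpec (StoneSp.comap (Inc.map π).pullback (stoneSpec.symm χ)),
    stoneSpec.continuous.comp ((map_continuous _).comp stoneSpec.symm.continuous)⟩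

theorem specMap_apply (π : X ⟶ Y) (χ : Spec X.Events) (f : LInf Y.Events) :
    specMap π χ f = χ (koopman π f) := by
  obtain ⟨z, rfl⟩ := stoneSpec.surjective χ
  rw [stoneSpec_apply, hat_koopman]
  simp only [specMap, ContinuousMap.coe_mk, Homeomorph.symm_apply_apply, stoneSpec_apply]

theorem specMap_preimage_stoneSet (π : X ⟶ Y) (E : Y.Events) :
    SigmaHom.preimage (specMap π) (measurable_baire _) (stoneSet E) =
      stoneSet ((Inc.map π).pullback E) := by
  refine Subtype.ext (Set.ext fun χ => ?_)
  obtain ⟨z, rfl⟩ := stoneSpec.surjective χ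
  change specMap π (stoneSpec z) ∈ specSet E ↔ _
  refine Iff.trans ?_ stoneSpec_mem_stoneSet.symm
  simp only [specMap, ContinuousMap.coe_mk, Homeomorph.symm_apply_apply, stoneSpec_mem_specSet]
  rfl

/-- Both composites are morphisms on the Baire algebra of `Stone Y`, so by `SigmaHom.ext_stone` they
need only be compared on the clopen sets of events, where naturality of `e` and `e'` settles the
matter. Preservation of measure then follows from the commuting square. -/
theorem exists_stoneMap {e : X ≅ (Stone X).toProbAlg} (he : IsNaturalIso e)
    {e' : Y ≅ (Stone Y).toProbAlg} (he' : IsNaturalIso e') (π : X ⟶ Y) :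
    ∃ T : Stone X ⟶ Stone Y, IsStoneMap π T ∧
      inclOfIso e ≫ CHProb.toAbsProb.map T = Inc.map π ≫ inclOfIso e' := by
  let R : SigmaHom (Stone Y).BaireSet (Stone X).BaireSet :=
    SigmaHom.preimage (specMap π) (measurable_baire _)
  have hR : (eventHom (inclOfIso e)).comp R =
      SigmaHom.comp (Inc.map π).pullback (eventHom (inclOfIso e')) := by
    refine SigmaHom.ext_stone fun E => ?_
    change eventHom (inclOfIso e) (R (stoneSet E)) =
      (Inc.map π).pullback (eventHom (inclOfIso e') (stoneSet E))
    rw [he'.eventHom_stoneSet]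
    exact (congrArg (eventHom (inclOfIso e)) (specMap_preimage_stoneSet π E)).trans
      (he.eventHom_stoneSet _)
  refine ⟨⟨specMap π, fun B => ?_⟩, specMap_apply π, AbsProb.hom_ext (DFunLike.congr_fun hR)⟩
  rw [← prob_eventHom (inclOfIso e')]
  refine (prob_eventHom (inclOfIso e) (R B)).symm.trans ?_
  refine (congrArg X.obj.prob.toFun (DFunLike.congr_fun hR B)).trans ?_
  exact (Inc.map π).prob_preserved _

end Naturality

theorem mono_inclOfIso {X : ProbAlg.{u}} {S : CHProb.{u}} (e : X ≅ S.toProbAlg) :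
    Mono (AbsProb.forgetToAbsMes.map (inclOfIso e)) :=
  (mono_iff_surjective _).2 (surjective_algInclusion_iso e)

/-- Initial objects are unique up to isomorphism and the canonical model is initial, so any initial
model inherits strong Lusin from it. -/
theorem Model.isInitial_iff {X : ProbAlg.{u}} (M : Model X) :
    Nonempty (Limits.IsInitial M) ↔ M.space.StrongLusin := by
  refine ⟨fun ⟨hM⟩ => ?_, Model.nonempty_isInitial⟩
  obtain ⟨hN⟩ := Model.nonempty_isInitial
    (M := ⟨Stone X, inclOfIso (stoneIso X), mono_inclOfIso _⟩) (stone_strongLusin X)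
  exact (stone_strongLusin X).of_iso ((Model.forget X).mapIso (hM.uniqueUpToIso hN))

end CanonModel

end

theorem proposition6p7 (X : ProbAlg.{u}) :
    -- (i) concrete models are the spaces whose probability algebra is isomorphic to `X`
    ((∀ M : Model X, ∃ e : X ≅ M.space.toProbAlg, M.incl = inclOfIso e) ∧
      (∀ (S : CHProb.{u}) (e : X ≅ S.toProbAlg),
        Mono (AbsProb.forgetToAbsMes.map (inclOfIso e)))) ∧
    -- (iii) the initial models are those with the strong Lusin property
    (∀ M : Model X, Nonempty (Limits.IsInitial M) ↔ M.space.StrongLusin) ∧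
    -- (ii) the canonical model is a concrete model, it is initial, and it is natural in `X`
    ∃ (e : X ≅ (Stone X).toProbAlg) (hmono : Mono (AbsProb.forgetToAbsMes.map (inclOfIso e))),
      IsNaturalIso e ∧
      Nonempty (Limits.IsInitial (⟨Stone X, inclOfIso e, hmono⟩ : Model X)) ∧
      ∀ (Y : ProbAlg.{u}) (e' : Y ≅ (Stone Y).toProbAlg), IsNaturalIso e' → ∀ π : X ⟶ Y,
        ∃ T : Stone X ⟶ Stone Y, IsStoneMap π T ∧
          inclOfIso e ≫ CHProb.toAbsProb.map T = Inc.map π ≫ inclOfIso e' :=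
  ⟨⟨fun M => exists_iso_of_surjective M.incl M.surjective, fun _ => mono_inclOfIso⟩,
    Model.isInitial_iff, stoneIso X, mono_inclOfIso _, isNaturalIso_stoneIso X,
    Model.nonempty_isInitial (stone_strongLusin X), fun _ _ he' =>
      exists_stoneMap (isNaturalIso_stoneIso X) he'⟩
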